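/- **Definitions.** A $\lambda$-structure on a commutative ring $R$ is a map $\lambda_t\colon R\to 1+tR[[t]]$, $\lambda_t(r)=\sum_{n\ge 0}\lambda_n(r)t^n$, with $\lambda_t(r)=1+rt+O(t^2)$ and $\lambda_t(r+s)=\lambda_t(r)\lambda_t(s)$; its Adams operations $\psi_n$ are defined by $\sum_{n\ge1}\psi_n(r)t^n=-t\frac{d}{dt}\log\lambda_{-t}(r)$. It is special if $\lambda_t$ is a homomorphism of $\lambda$-rings to $1+tR[[t]]$, where the latter has addition given by the product of power series, unit $1+t$, multiplication $*$ given by the universal polynomials for which $\prod_i(1+x_it)*\prod_j(1+y_jt)=\prod_{i,j}(1+x_iy_jt)$, and $\lambda$-operations given by the universal polynomials for which $\lambda_k\big(\prod_i(1+x_it)\big)=\prod_{i_1<\dots<i_k}(1+x_{i_1}\cdots x_{i_k}t)$. A graded $\lambda$-ring is a graded commutative ring $R=\bigoplus_{d\ge0}R_d$ (commutative in the ordinary sense) with a $\lambda$-structure such that $\lambda_n(R_d)\subset R_{nd}$ for all $n,d$; homomorphisms of graded $\lambda$-rings are the degree-preserving ring homomorphisms that commute with all $\lambda_k$, and $\mathrm{Hom}_{\mathsf{GrLR}}$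 denotes the set of them. Let $\mathrm{PS}_{\mathbb Z}$ be the ring of formal infinite sums, with integer coefficients and bounded degree, of monomials in indeterminates $x_{ij}$ ($i,j\ge1$, $\deg x_{ij}=i$) that are invariant under all permutations of the pairs $(i,j)$ preserving the first coordinate. It is graded by degree. Let $M_d=\sum_{j\ge1}x_{dj}\in \mathrm{PS}_{\mathbb Z}$. Let $\Lambda$ be the ring of symmetric functions in indeterminates $y_1,y_2,\dots$ of degree $1$, and let $\Lambda\langle n\rangle$ be $\Lambda$ with the grading supported in the multiples of $n$ and $\Lambda\langle n\rangle_{dn}=\Lambda_d$. **Theorem.** There are $\lambda$-structures on $\Lambda$ and on $\mathrm{PS}_{\mathbb Z}$ whose Adams operations are $\psi_nf(y_*)=f(y_*^n)$ and $\psi_ng(x_{**})=g(x_{**}^n)$ for $n\ge1$, and for which the following hold. 1. Both are special, and they make each $\Lambda\langle n\rangle$ ($n\ge1$) and $\mathrm{PS}_{\mathbb Z}$ graded $\lambda$-rings. 2. The degree-preserving ring homomorphisms $\Lambda\langle n\rangle\to\mathrm{PS}_{\mathbb Z}$, $y_j\mapsto x_{nj}$, commute with the $\lambda$-operations. They exhibit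 $\mathrm{PS}_{\mathbb Z}$ as the coproduct $\bigotimes_{n\ge1}\Lambda\langle n\rangle$ of graded commutative rings, and also as the coproduct of the $\Lambda\langle n\rangle$ in the category of special graded $\lambda$-rings. 3. $\mathrm{PS}_{\mathbb Z}$ is the free special graded $\lambda$-ring with one generator in each positive degree: for every special graded $\lambda$-ring $R=\bigoplus_{d\ge0}R_d$ the map $$\mathrm{Hom}_{\mathsf{GrLR}}(\mathrm{PS}_{\mathbb Z},R)\to\prod_{d=1}^\infty R_d,\qquad \phi\mapsto(\phi(M_d))_{d\ge1}$$ is a bijection. -/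

import Mathlib

open scoped PowerSeries

universe u

/-! ### Universal polynomials -/

namespace UniversalPoly

open MvPolynomial

/-- The elementary symmetric polynomial `e_n` evaluated at the `n²` products `x_i y_j`. -/
noncomputable def esymmProducts (n : ℕ) : MvPolynomial (Fin n ⊕ Fin n) ℤ :=
  aeval (fun p : Fin n × Fin n =>
    (X (Sum.inl p.1) * X (Sum.inr p.2) : MvPolynomial (Fin n ⊕ Fin n) ℤ))
    (esymm (Fin n × Fin n) ℤ n)

/-- The elementary symmetric polynomial `e_m` evaluated at all the products
`x_{i_1} ⋯ x_{i_k}` with `i_1 < ⋯ < i_k`, in `m k` variables. -/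
noncomputable def esymmSubsets (m k : ℕ) : MvPolynomial (Fin (m * k)) ℤ :=
  aeval (fun s : {s : Finset (Fin (m * k)) // s.card = k} =>
    (∏ i ∈ s.1, X i : MvPolynomial (Fin (m * k)) ℤ))
    (esymm {s : Finset (Fin (m * k)) // s.card = k} ℤ m)

theorem map_aeval_esymm {A B : Type*} [CommRing A] [CommRing B] (f : A →+* B) (n : ℕ)
    (G : MvPolynomial (Fin n) A) :
    map f (aeval (fun i : Fin n => esymm (Fin n) A (i + 1)) G) =
      aeval (fun i : Fin n => esymm (Fin n) B (i + 1)) (map f G) := by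
  induction G using MvPolynomial.induction_on with
  | C a => simp
  | add p q hp hq => simp only [map_add, hp, hq]
  | mul_X p i hp => simp only [map_mul, hp, aeval_X, map_X, map_esymm]

theorem sumAlgEquiv_rename_left (n : ℕ) (e : Equiv.Perm (Fin n))
    (G : MvPolynomial (Fin n ⊕ Fin n) ℤ) :
    sumAlgEquiv ℤ (Fin n) (Fin n) (rename (Sum.map e id) G) =
      rename e (sumAlgEquiv ℤ (Fin n) (Fin n) G) := by
  induction G using MvPolynomial.induction_on with
  | C a => simp
  | add p q hp hq => simp only [map_add, hp, hq]
  | mul_X p i hp => cases i <;> simp [hp]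

theorem sumAlgEquiv_rename_right (n : ℕ) (e : Equiv.Perm (Fin n))
    (G : MvPolynomial (Fin n ⊕ Fin n) ℤ) :
    sumAlgEquiv ℤ (Fin n) (Fin n) (rename (Sum.map id e) G) =
      map (rename (R := ℤ) e).toRingHom (sumAlgEquiv ℤ (Fin n) (Fin n) G) := by
  induction G using MvPolynomial.induction_on with
  | C a => simp
  | add p q hp hq => simp only [map_add, hp, hq]
  | mul_X p i hp => cases i <;> simp [hp]

theorem sumAlgEquiv_rename_inl (n : ℕ) (p : MvPolynomial (Fin n) ℤ) :
    sumAlgEquiv ℤ (Fin n) (Fin n) (rename Sum.inl p) = map C p := by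
  induction p using MvPolynomial.induction_on with
  | C a => simp
  | add p q hp hq => simp only [map_add, hp, hq]
  | mul_X p i hp => simp [hp]

theorem sumAlgEquiv_rename_inr (n : ℕ) (p : MvPolynomial (Fin n) ℤ) :
    sumAlgEquiv ℤ (Fin n) (Fin n) (rename Sum.inr p) = C p := by
  induction p using MvPolynomial.induction_on with
  | C a => simp
  | add p q hp hq => simp only [map_add, hp, hq]
  | mul_X p i hp => simp [hp]

theorem sumAlgEquiv_aeval (n : ℕ) (K : MvPolynomial (Fin n ⊕ Fin n) ℤ) :
    sumAlgEquiv ℤ (Fin n) (Fin n) (aeval (Sum.elim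
        (fun i : Fin n => rename Sum.inl (esymm (Fin n) ℤ (i + 1)))
        (fun i : Fin n => rename Sum.inr (esymm (Fin n) ℤ (i + 1)))) K) =
      aeval (fun i : Fin n => esymm (Fin n) (MvPolynomial (Fin n) ℤ) (i + 1))
        (map (aeval (R := ℤ) (fun i : Fin n => esymm (Fin n) ℤ (i + 1))).toRingHom
          (sumAlgEquiv ℤ (Fin n) (Fin n) K)) := by
  induction K using MvPolynomial.induction_on with
  | C a => simp
  | add p q hp hq => simp only [map_add, hp, hq]
  | mul_X p i hp =>
    simp only [map_mul, hp]
    cases i <;>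
      simp [sumAlgEquiv_rename_inl, sumAlgEquiv_rename_inr, map_esymm]

theorem exists_of_bisymmetric (n : ℕ) (F : MvPolynomial (Fin n ⊕ Fin n) ℤ)
    (h₁ : ∀ e : Equiv.Perm (Fin n), rename (Sum.map e id) F = F)
    (h₂ : ∀ e : Equiv.Perm (Fin n), rename (Sum.map id e) F = F) :
    ∃ P : MvPolynomial (Fin n ⊕ Fin n) ℤ,
      aeval (Sum.elim
        (fun i : Fin n => rename Sum.inl (esymm (Fin n) ℤ (i + 1)))
        (fun i : Fin n => rename Sum.inr (esymm (Fin n) ℤ (i + 1)))) P = F := by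
  have hsym : (sumAlgEquiv ℤ (Fin n) (Fin n) F).IsSymmetric := fun e => by
    rw [← sumAlgEquiv_rename_left, h₁]
  obtain ⟨G, hG⟩ := (esymmAlgHom_fin_bijective (MvPolynomial (Fin n) ℤ) n).2 ⟨_, hsym⟩
  have hG' : aeval (fun i : Fin n => esymm (Fin n) (MvPolynomial (Fin n) ℤ) (i + 1)) G =
      sumAlgEquiv ℤ (Fin n) (Fin n) F := by
    rw [← esymmAlgHom_apply, hG]
  have hGe : ∀ e : Equiv.Perm (Fin n), map (rename (R := ℤ) e).toRingHom G = G := by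
    intro e
    apply (esymmAlgHom_fin_bijective (MvPolynomial (Fin n) ℤ) n).1
    apply Subtype.ext
    rw [esymmAlgHom_apply, esymmAlgHom_apply, ← map_aeval_esymm, hG',
      ← sumAlgEquiv_rename_right, h₂]
  have hmem : G ∈ Set.range (map (σ := Fin n)
      (aeval (R := ℤ) (fun i : Fin n => esymm (Fin n) ℤ (i + 1))).toRingHom) := by
    rw [mem_range_map_iff_coeffs_subset]
    intro c hc
    obtain ⟨d, -, rfl⟩ := mem_coeffs_iff.1 hc
    have hc' : (coeff d G).IsSymmetric := fun e => by
      conv_rhs => rw [← hGe e, coeff_map]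
      rfl
    obtain ⟨p, hp⟩ := (esymmAlgHom_fin_bijective ℤ n).2 ⟨_, hc'⟩
    refine ⟨p, ?_⟩
    have := congrArg Subtype.val hp
    rw [esymmAlgHom_apply] at this
    exact this
  obtain ⟨H, hH⟩ := hmem
  refine ⟨(sumAlgEquiv ℤ (Fin n) (Fin n)).symm H, ?_⟩
  apply (sumAlgEquiv ℤ (Fin n) (Fin n)).injective
  rw [sumAlgEquiv_aeval, AlgEquiv.apply_symm_apply, hH, hG']

theorem exists_mulPoly (n : ℕ) : ∃ P : MvPolynomial (Fin n ⊕ Fin n) ℤ,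
    aeval (Sum.elim
      (fun i : Fin n => rename Sum.inl (esymm (Fin n) ℤ (i + 1)))
      (fun i : Fin n => rename Sum.inr (esymm (Fin n) ℤ (i + 1)))) P = esymmProducts n := by
  apply exists_of_bisymmetric
  · intro e
    have := rename_esymm (Fin n × Fin n) ℤ n (e.prodCongr (Equiv.refl _))
    conv_rhs => rw [esymmProducts, ← this, aeval_rename]
    rw [esymmProducts, ← AlgHom.comp_apply, comp_aeval]
    congr 2
    ext1 p
    simp
  · intro e
    have := rename_esymm (Fin n × Fin n) ℤ n ((Equiv.refl _).prodCongr e)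
    conv_rhs => rw [esymmProducts, ← this, aeval_rename]
    rw [esymmProducts, ← AlgHom.comp_apply, comp_aeval]
    congr 2
    ext1 p
    simp

theorem exists_lamPoly (m k : ℕ) : ∃ P : MvPolynomial (Fin (m * k)) ℤ,
    aeval (fun i : Fin (m * k) => esymm (Fin (m * k)) ℤ (i + 1)) P = esymmSubsets m k := by
  have hsym : (esymmSubsets m k).IsSymmetric := by
    intro e
    let e' : {s : Finset (Fin (m * k)) // s.card = k} ≃
        {s : Finset (Fin (m * k)) // s.card = k} :=
      (Equiv.finsetCongr e).subtypeEquiv (fun s => by simp)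
    have := rename_esymm {s : Finset (Fin (m * k)) // s.card = k} ℤ m e'
    conv_rhs => rw [esymmSubsets, ← this, aeval_rename]
    rw [esymmSubsets, ← AlgHom.comp_apply, comp_aeval]
    congr 2
    ext1 p
    simp [e']
  obtain ⟨p, hp⟩ := (esymmAlgHom_fin_bijective ℤ (m * k)).2 ⟨_, hsym⟩
  refine ⟨p, ?_⟩
  rw [← esymmAlgHom_apply, hp]

/-- The universal polynomial `P_n(a_1, …, a_n; b_1, …, b_n)` characterised by
`P_n(e_1(x), …, e_n(x); e_1(y), …, e_n(y)) = e_n(x_i y_j : i, j)`.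
The variables `Sum.inl i`, `Sum.inr i` (`0 ≤ i < n`) are `a_{i+1}`, `b_{i+1}`. -/
noncomputable def mulPoly (n : ℕ) : MvPolynomial (Fin n ⊕ Fin n) ℤ :=
  (exists_mulPoly n).choose

/-- The universal polynomial `P_{m,k}(a_1, …, a_{mk})` characterised by
`P_{m,k}(e_1(x), …, e_{mk}(x)) = e_m(x_{i_1} ⋯ x_{i_k} : i_1 < ⋯ < i_k)`.
The variable `i` (`0 ≤ i < m k`) is `a_{i+1}`. -/
noncomputable def lamPoly (m k : ℕ) : MvPolynomial (Fin (m * k)) ℤ :=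
  (exists_lamPoly m k).choose

end UniversalPoly

/-! ### λ-structures -/

/-- A `λ`-structure on a commutative ring `R`: a map `λ_t : R → 1 + t R⟦t⟧` with
`λ_t(r) = 1 + r t + O(t²)` and `λ_t(r + s) = λ_t(r) λ_t(s)`. -/
structure LambdaStructure (R : Type*) [CommRing R] where
  series : R → R⟦X⟧
  coeff_zero : ∀ r, PowerSeries.coeff 0 (series r) = 1
  coeff_one : ∀ r, PowerSeries.coeff 1 (series r) = r
  series_add : ∀ r s, series (r + s) = series r * series s

namespace LambdaStructure

/-- Multiplication `∗` of the ring `1 + t R⟦t⟧` (whose addition is the product of power series),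
given by the universal polynomials, so that `(1 + a t) ∗ (1 + b t) = 1 + a b t`. -/
noncomputable def wittMul {R : Type*} [CommRing R] (f g : R⟦X⟧) : R⟦X⟧ :=
  PowerSeries.mk fun n =>
    MvPolynomial.aeval (Sum.elim
      (fun i : Fin n => PowerSeries.coeff (i + 1) f)
      (fun i : Fin n => PowerSeries.coeff (i + 1) g)) (UniversalPoly.mulPoly n)

/-- The `k`-th `λ`-operation of the canonical `λ`-structure on `1 + t R⟦t⟧`, given by the
universal polynomials: it sends `∏ (1 + x_i t)` to `∏_{i_1 < ⋯ < i_k} (1 + x_{i_1} ⋯ x_{i_k} t)`. -/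
noncomputable def wittLam {R : Type*} [CommRing R] (k : ℕ) (f : R⟦X⟧) : R⟦X⟧ :=
  PowerSeries.mk fun m =>
    MvPolynomial.aeval (fun i : Fin (m * k) => PowerSeries.coeff (i + 1) f)
      (UniversalPoly.lamPoly m k)

variable {R : Type*} [CommRing R] (L : LambdaStructure R)

/-- The operation `λ_n`, the coefficient of `t ^ n` in `λ_t`. -/
noncomputable def lam (n : ℕ) (r : R) : R := PowerSeries.coeff n (L.series r)

/-- The `n`-th Adams operation, defined by
`∑_{n ≥ 1} ψ_n(r) t^n = - t (d/dt) log (λ_{-t}(r))`. -/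
noncomputable def adams (n : ℕ) (r : R) : R :=
  PowerSeries.coeff n
    (-(PowerSeries.X * PowerSeries.derivative R (PowerSeries.evalNegHom (L.series r)) *
      PowerSeries.invOfUnit (PowerSeries.evalNegHom (L.series r)) 1))

/-- A `λ`-structure is special if `λ_t : R → 1 + t R⟦t⟧` is a homomorphism of `λ`-rings
(additivity is part of the definition of a `λ`-structure; the unit of `1 + t R⟦t⟧` is `1 + t`). -/
structure IsSpecial : Prop where
  series_one : L.series 1 = 1 + PowerSeries.X
  series_mul : ∀ r s, L.series (r * s) = wittMul (L.series r) (L.series s)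
  series_lam : ∀ k r, L.series (L.lam k r) = wittLam k (L.series r)

/-- `(R, λ)` is a graded `λ`-ring for the grading `R = ⨁ 𝒜 d` if `λ_n(𝒜 d) ⊆ 𝒜 (n d)`. -/
def IsGraded (𝒜 : ℕ → AddSubgroup R) : Prop :=
  ∀ n d, ∀ r ∈ 𝒜 d, L.lam n r ∈ 𝒜 (n * d)

end LambdaStructure

/-- Homomorphisms of graded `λ`-rings: ring homomorphisms that preserve degrees and commute with
all the operations `λ_k`. -/
structure GradedLambdaHom {R S : Type*} [CommRing R] [CommRing S]
    (𝒜 : ℕ → AddSubgroup R) (L : LambdaStructure R)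
    (ℬ : ℕ → AddSubgroup S) (M : LambdaStructure S) extends GradedRingHom 𝒜 ℬ where
  map_lam : ∀ k, 1 ≤ k → ∀ r, toRingHom (L.lam k r) = M.lam k (toRingHom r)

/-- The grading of `A⟨n⟩`: supported in degrees divisible by `n`, with `A⟨n⟩_{d n} = A_d`. -/
def scaledGrading {A : Type*} [CommRing A] (𝒜 : ℕ → AddSubgroup A) (n : ℕ) (d : ℕ) :
    AddSubgroup A :=
  if n ∣ d then 𝒜 (d / n) else ⊥

/-! ### Symmetric and polysymmetric functions -/

section Invariants

variable {σ : Type*} (w : σ → ℕ)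

/-- The ring of formal infinite sums of monomials in variables `x_s` of degree `w s`, with
integer coefficients and bounded degree, that are invariant under all permutations of the
variables that preserve their degrees. -/
def boundedInvariants : Subring (MvPowerSeries σ ℤ) where
  carrier := {f | (∃ N, ∀ m, MvPowerSeries.coeff m f ≠ 0 → Finsupp.weight w m ≤ N) ∧
    ∀ g : Equiv.Perm σ, (∀ s, w (g s) = w s) → MvPowerSeries.renameEquiv ℤ g f = f}
  zero_mem' := ⟨⟨0, by simp⟩, by simp⟩
  one_mem' := by
    classical
    refine ⟨⟨0, fun m hm => ?_⟩, by simp⟩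
    rw [MvPowerSeries.coeff_one] at hm
    have : m = 0 := by by_contra h; simp [h] at hm
    simp [this]
  add_mem' := by
    rintro a b ⟨⟨N, hN⟩, ha⟩ ⟨⟨M, hM⟩, hb⟩
    refine ⟨⟨max N M, fun m hm => ?_⟩, fun g hg => by rw [map_add, ha g hg, hb g hg]⟩
    by_contra! h
    have h1 : MvPowerSeries.coeff m a = 0 := by
      by_contra h'; have := hN m h'; omega
    have h2 : MvPowerSeries.coeff m b = 0 := by
      by_contra h'; have := hM m h'; omega
    simp [h1, h2] at hm
  neg_mem' := by
    rintro a ⟨⟨N, hN⟩, ha⟩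
    exact ⟨⟨N, fun m hm => hN m (by simpa using hm)⟩, fun g hg => by rw [map_neg, ha g hg]⟩
  mul_mem' := by
    classical
    rintro a b ⟨⟨N, hN⟩, ha⟩ ⟨⟨M, hM⟩, hb⟩
    refine ⟨⟨N + M, fun m hm => ?_⟩, fun g hg => by rw [map_mul, ha g hg, hb g hg]⟩
    rw [MvPowerSeries.coeff_mul] at hm
    obtain ⟨p, hp, hne⟩ := Finset.exists_ne_zero_of_sum_ne_zero hm
    rw [← Finset.HasAntidiagonal.mem_antidiagonal.1 hp, map_add]
    exact add_le_add (hN _ (left_ne_zero_of_mul hne)) (hM _ (right_ne_zero_of_mul hne))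

/-- The homogeneous elements of degree `d`: all their monomials have degree `d`. -/
def homogeneousPart (d : ℕ) : AddSubgroup (boundedInvariants w) where
  carrier := {f | ∀ m, MvPowerSeries.coeff m (f : MvPowerSeries σ ℤ) ≠ 0 → Finsupp.weight w m = d}
  zero_mem' := by simp
  add_mem' := by
    intro a b ha hb m hm
    by_contra h
    have h1 : MvPowerSeries.coeff m (a : MvPowerSeries σ ℤ) = 0 := by
      by_contra h'; exact h (ha m h')
    have h2 : MvPowerSeries.coeff m (b : MvPowerSeries σ ℤ) = 0 := by
      by_contra h'; exact h (hb m h')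
    simp [h1, h2] at hm
  neg_mem' := by
    intro a ha m hm
    exact ha m (by simpa using hm)

theorem weight_mapDomain_perm (g : Equiv.Perm σ) (hg : ∀ s, w (g s) = w s) (m : σ →₀ ℕ) :
    Finsupp.weight w (Finsupp.mapDomain g m) = Finsupp.weight w m := by
  simp [Finsupp.weight_apply, Finsupp.sum_mapDomain_index, add_mul, hg]

theorem coeff_renameEquiv_mapDomain (g : Equiv.Perm σ) (f : MvPowerSeries σ ℤ) (m : σ →₀ ℕ) :
    MvPowerSeries.coeff (Finsupp.mapDomain g m) (MvPowerSeries.renameEquiv ℤ g f) =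
      MvPowerSeries.coeff m f := by
  have := MvPowerSeries.coeff_embDomain_rename g.toEmbedding f m
  rw [Finsupp.embDomain_eq_mapDomain] at this
  exact this

theorem renameEquiv_eq_iff (g : Equiv.Perm σ) (f : MvPowerSeries σ ℤ) :
    MvPowerSeries.renameEquiv ℤ g f = f ↔
      ∀ m, MvPowerSeries.coeff (Finsupp.mapDomain g m) f = MvPowerSeries.coeff m f := by
  constructor
  · intro h m
    conv_lhs => rw [← h]
    exact coeff_renameEquiv_mapDomain g f m
  · intro h
    ext m
    obtain ⟨m', rfl⟩ : ∃ m', Finsupp.mapDomain g m' = m :=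
      ⟨Finsupp.mapDomain g.symm m, by simp [← Finsupp.mapDomain_comp]⟩
    rw [coeff_renameEquiv_mapDomain, h]

/-- The homogeneous component of degree `d`. -/
noncomputable def homogeneousComponent (d : ℕ) (f : boundedInvariants w) :
    homogeneousPart w d := by
  refine ⟨⟨MvPowerSeries.weightedHomogeneousComponent w d f.1, ⟨d, fun m hm => ?_⟩,
    fun g hg => ?_⟩, fun m hm => ?_⟩
  · rw [MvPowerSeries.coeff_weightedHomogeneousComponent] at hm
    by_contra h
    rw [if_neg (by omega)] at hm
    exact hm rfl
  · rw [renameEquiv_eq_iff]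
    intro m
    rw [MvPowerSeries.coeff_weightedHomogeneousComponent,
      MvPowerSeries.coeff_weightedHomogeneousComponent, weight_mapDomain_perm w g hg,
      (renameEquiv_eq_iff g f.1).1 (f.2.2 g hg)]
  · by_contra h
    rw [MvPowerSeries.coeff_weightedHomogeneousComponent, if_neg h] at hm
    exact hm rfl

theorem coeff_coe_sum (x : DirectSum ℕ fun d => homogeneousPart w d) (m : σ →₀ ℕ) :
    MvPowerSeries.coeff m
      (DirectSum.coeAddMonoidHom (homogeneousPart w) x : MvPowerSeries σ ℤ) =
    MvPowerSeries.coeff m (x (Finsupp.weight w m) : MvPowerSeries σ ℤ) := by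
  induction x using DirectSum.induction_on with
  | zero => simp
  | of d y =>
    rw [DirectSum.coeAddMonoidHom_of]
    by_cases h : Finsupp.weight w m = d
    · subst h; rw [DirectSum.of_eq_same]
    · rw [DirectSum.of_eq_of_ne _ _ _ h]
      simpa using not_imp_comm.1 (y.2 m) h
  | add x y hx hy => simp [hx, hy]

theorem isInternal_homogeneousPart : DirectSum.IsInternal (homogeneousPart w) := by
  constructor
  · rw [injective_iff_map_eq_zero]
    intro x hx
    refine DFinsupp.ext fun d => Subtype.ext (Subtype.ext (MvPowerSeries.ext fun m => ?_))
    by_cases h : Finsupp.weight w m = d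
    · subst h
      rw [← coeff_coe_sum, hx]
      rfl
    · by_contra h'
      exact h ((x d).2 m (by simpa using h'))
  · intro f
    obtain ⟨N, hN⟩ := f.2.1
    refine ⟨∑ d ∈ Finset.range (N + 1),
      DirectSum.of (fun d => homogeneousPart w d) d (homogeneousComponent w d f), ?_⟩
    refine Subtype.ext (MvPowerSeries.ext fun m => ?_)
    rw [coeff_coe_sum, DFinsupp.finsetSum_apply]
    by_cases hm : Finsupp.weight w m ∈ Finset.range (N + 1)
    · rw [Finset.sum_eq_single_of_mem _ hm]
      · erw [DirectSum.of_eq_same]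
        simp [homogeneousComponent, MvPowerSeries.coeff_weightedHomogeneousComponent]
      · intro d _ hd
        exact DirectSum.of_eq_of_ne _ _ _ hd.symm
    · rw [Finset.sum_eq_zero]
      · have : MvPowerSeries.coeff m f.1 = 0 := by
          by_contra h'
          have := hN m h'
          simp at hm
          omega
        rw [this]
        rfl
      · intro d hd
        exact DirectSum.of_eq_of_ne _ _ _ (by rintro rfl; exact hm hd)

noncomputable instance : GradedRing (homogeneousPart w) where
  one_mem := by
    classical
    intro m hm
    have hm' : MvPowerSeries.coeff m (1 : MvPowerSeries σ ℤ) ≠ 0 := hm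
    rw [MvPowerSeries.coeff_one] at hm'
    have : m = 0 := by by_contra h; simp [h] at hm'
    simp [this]
  mul_mem := by
    classical
    intro i j a b ha hb m hm
    have hm' : MvPowerSeries.coeff m (a.1 * b.1) ≠ 0 := hm
    rw [MvPowerSeries.coeff_mul] at hm'
    obtain ⟨p, hp, hne⟩ := Finset.exists_ne_zero_of_sum_ne_zero hm'
    rw [← Finset.HasAntidiagonal.mem_antidiagonal.1 hp, map_add, ha _ (left_ne_zero_of_mul hne),
      hb _ (right_ne_zero_of_mul hne)]
  toDecomposition := (isInternal_homogeneousPart w).chooseDecomposition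

end Invariants

/-- The ring `Λ_ℤ` of symmetric functions, in variables `y_j` (`j ≥ 1`) of degree `1`. -/
abbrev SymFun : Subring (MvPowerSeries ℕ+ ℤ) := boundedInvariants (fun _ : ℕ+ => 1)

/-- The grading of `Λ_ℤ`. -/
abbrev SymFun.grading : ℕ → AddSubgroup SymFun := homogeneousPart (fun _ : ℕ+ => 1)

/-- The ring `PS_ℤ` of polysymmetric functions, in variables `x_{ij}` (`i, j ≥ 1`) of degree `i`:
a permutation of the pairs `(i, j)` preserves degrees iff it preserves the first coordinate. -/
abbrev PolySymFun : Subring (MvPowerSeries (ℕ+ × ℕ+) ℤ) :=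
  boundedInvariants (fun p : ℕ+ × ℕ+ => (p.1 : ℕ))

/-- The grading of `PS_ℤ`. -/
abbrev PolySymFun.grading : ℕ → AddSubgroup PolySymFun :=
  homogeneousPart (fun p : ℕ+ × ℕ+ => (p.1 : ℕ))

namespace PolySymFun

open Classical in
/-- The formal sum `∑_j x_{dj}`. -/
noncomputable def sumVars (d : ℕ+) : MvPowerSeries (ℕ+ × ℕ+) ℤ :=
  fun m => if ∃ j, m = Finsupp.single (d, j) 1 then 1 else 0

open Classical in
theorem coeff_sumVars (d : ℕ+) (m : ℕ+ × ℕ+ →₀ ℕ) :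
    MvPowerSeries.coeff m (sumVars d) = if ∃ j, m = Finsupp.single (d, j) 1 then 1 else 0 := rfl

theorem weight_of_coeff_sumVars {d : ℕ+} {m : ℕ+ × ℕ+ →₀ ℕ}
    (hm : MvPowerSeries.coeff m (sumVars d) ≠ 0) :
    Finsupp.weight (fun p : ℕ+ × ℕ+ => (p.1 : ℕ)) m = d := by
  rw [coeff_sumVars] at hm
  obtain ⟨j, rfl⟩ : ∃ j, m = Finsupp.single (d, j) 1 := by
    by_contra h; rw [if_neg h] at hm; exact hm rfl
  simp [Finsupp.weight_single]

/-- The monomial polysymmetric function `M_d = ∑_j x_{dj}`, of type `(d^1)`. -/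
noncomputable def M (d : ℕ+) : PolySymFun := by
  refine ⟨sumVars d, ⟨d, fun m hm => (weight_of_coeff_sumVars hm).le⟩, fun g hg => ?_⟩
  rw [renameEquiv_eq_iff]
  intro m
  have hg1 : ∀ p, (g p).1 = p.1 := fun p => PNat.coe_injective (hg p)
  have hg2 : ∀ p, (g.symm p).1 = p.1 := fun p => by
    conv_rhs => rw [← g.apply_symm_apply p, hg1]
  have key : (∃ j, Finsupp.mapDomain g m = Finsupp.single (d, j) 1) ↔
      ∃ j, m = Finsupp.single (d, j) 1 := by
    constructor
    · rintro ⟨j, h⟩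
      refine ⟨(g.symm (d, j)).2, ?_⟩
      apply Finsupp.mapDomain_injective g.injective
      have : (d, (g.symm (d, j)).2) = g.symm (d, j) := Prod.ext (hg2 (d, j)).symm rfl
      rw [h, Finsupp.mapDomain_single, this, g.apply_symm_apply]
    · rintro ⟨j, rfl⟩
      refine ⟨(g (d, j)).2, ?_⟩
      have : (d, (g (d, j)).2) = g (d, j) := Prod.ext (hg1 (d, j)).symm rfl
      rw [Finsupp.mapDomain_single, this]
  rw [coeff_sumVars, coeff_sumVars]
  by_cases h : ∃ j, m = Finsupp.single (d, j) 1
  · rw [if_pos (key.2 h), if_pos h]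
  · rw [if_neg (fun h' => h (key.1 h')), if_neg h]

theorem M_mem (d : ℕ+) : M d ∈ grading d := fun _ hm => weight_of_coeff_sumVars hm

/-- The embedding of the variables `y_j ↦ x_{nj}`. -/
def block (n : ℕ+) : ℕ+ ↪ ℕ+ × ℕ+ := ⟨fun j => (n, j), fun _ _ h => (Prod.ext_iff.1 h).2⟩

theorem weight_block (n : ℕ+) (m : ℕ+ →₀ ℕ) :
    Finsupp.weight (fun p : ℕ+ × ℕ+ => (p.1 : ℕ)) (Finsupp.embDomain (block n) m) =
      Finsupp.weight (fun _ : ℕ+ => 1) m * n := by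
  rw [Finsupp.embDomain_eq_mapDomain, Finsupp.weight_apply, Finsupp.weight_apply,
    Finsupp.sum_mapDomain_index (by simp) (by intros; simp [add_mul]), Finsupp.sum,
    Finsupp.sum, Finset.sum_mul]
  simp only [smul_eq_mul, mul_one]
  rfl

theorem exists_of_coeff_rename_block {n : ℕ+} {f : MvPowerSeries ℕ+ ℤ} {m : ℕ+ × ℕ+ →₀ ℕ}
    (h : MvPowerSeries.coeff m (MvPowerSeries.rename (block n) f) ≠ 0) :
    ∃ k, m = Finsupp.embDomain (block n) k ∧ MvPowerSeries.coeff k f ≠ 0 := by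
  by_cases hm : m ∈ Set.range (Finsupp.mapDomain (M := ℕ) (block n))
  · obtain ⟨k, rfl⟩ := hm
    rw [← Finsupp.embDomain_eq_mapDomain] at h ⊢
    exact ⟨k, rfl, by simpa using h⟩
  · exact absurd (MvPowerSeries.coeff_rename_eq_zero _ _ hm) h

/-- The inclusion `Λ_ℤ⟨n⟩ → PS_ℤ` of graded rings induced by `y_j ↦ x_{nj}`. -/
noncomputable def incl (n : ℕ+) : GradedRingHom (scaledGrading SymFun.grading n) grading where
  toRingHom := RingHom.codRestrict
    ((MvPowerSeries.rename (R := ℤ) (block n)).toRingHom.comp SymFun.subtype) PolySymFun (by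
      rintro ⟨f, ⟨N, hN⟩, hf⟩
      refine ⟨⟨N * n, fun m hm => ?_⟩, fun g hg => ?_⟩
      · obtain ⟨k, rfl, hk⟩ := exists_of_coeff_rename_block hm
        rw [weight_block]
        exact Nat.mul_le_mul_right _ (hN k hk)
      · have hg1 : ∀ p, (g p).1 = p.1 := fun p => PNat.coe_injective (hg p)
        have hg2 : ∀ p, (g.symm p).1 = p.1 := fun p => by
          conv_rhs => rw [← g.apply_symm_apply p, hg1]
        let g' : Equiv.Perm ℕ+ :=
          { toFun := fun j => (g (n, j)).2
            invFun := fun j => (g.symm (n, j)).2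
            left_inv := fun j => by
              have : (n, (g (n, j)).2) = g (n, j) := Prod.ext (hg1 (n, j)).symm rfl
              simp only [this, g.symm_apply_apply]
            right_inv := fun j => by
              have : (n, (g.symm (n, j)).2) = g.symm (n, j) := Prod.ext (hg2 (n, j)).symm rfl
              simp only [this, g.apply_symm_apply] }
        have hgg : (g : ℕ+ × ℕ+ → ℕ+ × ℕ+) ∘ block n = block n ∘ g' := by
          funext j
          exact Prod.ext (hg1 (n, j)) rfl
        have h1 := hf g' (fun _ => rfl)
        change MvPowerSeries.rename g (MvPowerSeries.rename (block n) f) =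
          MvPowerSeries.rename (block n) f
        have h2 : MvPowerSeries.rename g' f = f := h1
        conv_rhs => rw [← h2]
        rw [MvPowerSeries.rename_rename, MvPowerSeries.rename_rename]
        simp only [hgg])
  map_mem := by
    intro d f hf m hm
    obtain ⟨k, rfl, hk⟩ := exists_of_coeff_rename_block hm
    rw [weight_block]
    unfold scaledGrading at hf
    split_ifs at hf with h
    · rw [hf k hk, Nat.div_mul_cancel h]
    · rw [AddSubgroup.mem_bot] at hf
      subst hf
      exact absurd rfl hk

end PolySymFun

/-!
Over a torsion-free ring, Newton's identities determine a `λ`-structure by its Adams operations.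
Hence such a structure is special as soon as its Adams operations are ring homomorphisms with
`ψ_m ∘ ψ_n = ψ_{mn}`: by the splitting principle it suffices to compare the universal polynomials
with their values at products `∏ (1 + x_i t)`, where the Adams operations are power sums. On power
series, `λ_t` is the possibly infinite product of the `(1 + m t)^c` over the terms `c m`, taken in
the quotients by the ideals of series supported outside a finite down-set of exponents; it restricts
to invariants of bounded degree because these are closed under `ψ_n` and under division by integers.

`PS_ℤ` is the polynomial ring on the `λ_j(M_i)`: the monomial of `λ_j(M_i)` with the least sum of
second indices is `x_{i1} ⋯ x_{ij}`, the products of these are exactly the monomials whose exponents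
decrease along each block, and by symmetry every cheapest monomial of a polysymmetric function is of
this kind. Both coproduct properties and the freeness follow, since the elements whose `λ_t` is
preserved by a ring homomorphism form a subring stable under the `λ_k`.
-/

section GhostSeries

open PowerSeries Finset

variable {R S : Type*} [CommRing R] [CommRing S] {f g : R⟦X⟧}

/-- The power series `-t (d/dt) log f(-t)`, whose coefficients are the power sums of the `x_i` when
`f = ∏ (1 + x_i t)`. As in `LambdaStructure.adams`, division by `f(-t)` is meaningful only when `f`
has constant coefficient one. -/
noncomputable def ghostSeries (f : R⟦X⟧) : R⟦X⟧ :=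
  -(X * derivative R (evalNegHom f) * invOfUnit (evalNegHom f) 1)

theorem coeff_evalNegHom (n : ℕ) (f : R⟦X⟧) :
    coeff n (evalNegHom f) = (-1) ^ n * coeff n f := by
  simp [evalNegHom, coeff_rescale]

theorem evalNegHom_evalNegHom (f : R⟦X⟧) : evalNegHom (evalNegHom f) = f := by
  ext n
  simp [coeff_evalNegHom, ← mul_assoc, ← mul_pow]

theorem map_evalNegHom (φ : R →+* S) (f : R⟦X⟧) :
    map φ (evalNegHom f) = evalNegHom (map φ f) := by
  ext n
  simp [coeff_evalNegHom]

theorem coeff_X_mul_derivative (n : ℕ) (f : R⟦X⟧) :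
    coeff n (X * derivative R f) = n * coeff n f := by
  cases n with
  | zero => simp
  | succ n => rw [coeff_succ_X_mul, coeff_derivative, mul_comm, Nat.cast_succ]

theorem evalNegHom_X_mul_derivative_evalNegHom (f : R⟦X⟧) :
    evalNegHom (X * derivative R (evalNegHom f)) = X * derivative R f := by
  ext n
  rw [coeff_evalNegHom, coeff_X_mul_derivative, coeff_X_mul_derivative, coeff_evalNegHom,
    mul_left_comm, ← mul_assoc ((-1) ^ n), ← mul_pow]
  simp

theorem coeff_zero_ghostSeries (f : R⟦X⟧) : coeff 0 (ghostSeries f) = 0 := by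
  simp [ghostSeries, mul_assoc]

-- Substituting `-t` for `t` removes the signs from `f` and leaves a single one on `g`.
theorem ghostSeries_eq_iff (hf : constantCoeff f = 1) :
    ghostSeries f = g ↔ X * derivative R f = -(evalNegHom g * f) := by
  have hinv : evalNegHom f * invOfUnit (evalNegHom f) 1 = 1 := by
    apply mul_invOfUnit
    simpa [hf] using coeff_evalNegHom 0 f
  calc ghostSeries f = g
      ↔ X * derivative R (evalNegHom f) = -(g * evalNegHom f) := by
        rw [ghostSeries]
        constructor <;> intro h
        · linear_combination -evalNegHom f * h - X * derivative R (evalNegHom f) * hinv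
        · linear_combination -invOfUnit (evalNegHom f) 1 * h + g * hinv
    _ ↔ evalNegHom (X * derivative R (evalNegHom f)) = evalNegHom (-(g * evalNegHom f)) :=
        (Function.LeftInverse.injective evalNegHom_evalNegHom).eq_iff.symm
    _ ↔ X * derivative R f = -(evalNegHom g * f) := by
        rw [evalNegHom_X_mul_derivative_evalNegHom, map_neg, map_mul, evalNegHom_evalNegHom]

theorem X_mul_derivative_eq (hf : constantCoeff f = 1) :
    X * derivative R f = -(evalNegHom (ghostSeries f) * f) :=
  (ghostSeries_eq_iff hf).1 rfl

theorem ghostSeries_one : ghostSeries (1 : R⟦X⟧) = 0 :=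
  (ghostSeries_eq_iff (map_one _)).2 (by simp)

theorem ghostSeries_mul (hf : constantCoeff f = 1) (hg : constantCoeff g = 1) :
    ghostSeries (f * g) = ghostSeries f + ghostSeries g := by
  rw [ghostSeries_eq_iff (by rw [map_mul, hf, hg, one_mul]), Derivation.leibniz, map_add,
    smul_eq_mul, smul_eq_mul]
  linear_combination g * X_mul_derivative_eq hf + f * X_mul_derivative_eq hg

theorem ghostSeries_prod {ι : Type*} (s : Finset ι) (f : ι → R⟦X⟧)
    (hf : ∀ i, constantCoeff (f i) = 1) :
    ghostSeries (∏ i ∈ s, f i) = ∑ i ∈ s, ghostSeries (f i) := by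
  induction s using Finset.cons_induction with
  | empty => simp [ghostSeries_one]
  | cons a s ha ih =>
    rw [prod_cons, sum_cons, ghostSeries_mul (hf a) (by simp [map_prod, hf]), ih]

theorem constantCoeff_map_eq_one (φ : R →+* S) (hf : constantCoeff f = 1) :
    constantCoeff (map φ f) = 1 := by
  rw [← coeff_zero_eq_constantCoeff_apply, coeff_map, coeff_zero_eq_constantCoeff_apply, hf,
    map_one]

theorem map_ghostSeries (φ : R →+* S) (hf : constantCoeff f = 1) :
    map φ (ghostSeries f) = ghostSeries (map φ f) := by
  have hderiv : map φ (X * derivative R f) = X * derivative S (map φ f) := by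
    ext n
    rw [coeff_map, coeff_X_mul_derivative, coeff_X_mul_derivative, coeff_map, map_mul, map_natCast]
  symm
  rw [ghostSeries_eq_iff (constantCoeff_map_eq_one φ hf), ← hderiv, X_mul_derivative_eq hf,
    map_neg, map_mul, map_evalNegHom]

theorem ghostSeries_eq_iff_newton (hf : constantCoeff f = 1) :
    ghostSeries f = g ↔ ∀ n : ℕ, n * coeff n f =
      -∑ p ∈ antidiagonal n, (-1) ^ p.1 * coeff p.1 g * coeff p.2 f := by
  rw [ghostSeries_eq_iff hf, PowerSeries.ext_iff]
  refine forall_congr' fun n => ?_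
  simp only [coeff_X_mul_derivative n f, map_neg, coeff_mul n (evalNegHom g), coeff_evalNegHom]

theorem coeff_ghostSeries_one_add_C_mul_X (x : R) {n : ℕ} (hn : n ≠ 0) :
    coeff n (ghostSeries (1 + C x * X)) = x ^ n := by
  have hpow : ghostSeries (1 + C x * X) = mk fun n => if n = 0 then 0 else x ^ n := by
    rw [ghostSeries_eq_iff (by simp)]
    ext n
    rw [coeff_X_mul_derivative, map_neg, mul_add, mul_one, ← mul_assoc, map_add, map_add]
    rcases n with _ | _ | n
    · simp [coeff_zero_mul_X, coeff_evalNegHom, -coeff_zero_eq_constantCoeff]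
    · simp [coeff_one, coeff_succ_mul_X, coeff_mul_C, coeff_evalNegHom]
    · simp [coeff_one, coeff_succ_mul_X, coeff_mul_C, coeff_evalNegHom, pow_succ]
      ring
  rw [hpow, coeff_mk, if_neg hn]

theorem coeff_eq_of_coeff_ghostSeries_eq [IsAddTorsionFree R] (hf : constantCoeff f = 1)
    (hg : constantCoeff g = 1) {N : ℕ}
    (h : ∀ n ≤ N, n ≠ 0 → coeff n (ghostSeries f) = coeff n (ghostSeries g)) :
    ∀ n ≤ N, coeff n f = coeff n g := by
  intro n
  induction n using Nat.strong_induction_on with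
  | _ n ih =>
    intro hn
    rcases eq_or_ne n 0 with rfl | hn0
    · rw [coeff_zero_eq_constantCoeff_apply, coeff_zero_eq_constantCoeff_apply, hf, hg]
    apply nsmul_right_injective hn0
    simp only [nsmul_eq_mul]
    rw [(ghostSeries_eq_iff_newton hf).1 rfl, (ghostSeries_eq_iff_newton hg).1 rfl]
    congr 1
    refine sum_congr rfl fun p hp => ?_
    rw [HasAntidiagonal.mem_antidiagonal] at hp
    rcases eq_or_ne p.1 0 with hp0 | hp0
    · simp only [hp0, coeff_zero_ghostSeries, mul_zero, zero_mul]
    · rw [h _ (by omega) hp0, ih _ (by omega) (by omega)]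

theorem eq_of_coeff_ghostSeries_eq [IsAddTorsionFree R] (hf : constantCoeff f = 1)
    (hg : constantCoeff g = 1)
    (h : ∀ n, n ≠ 0 → coeff n (ghostSeries f) = coeff n (ghostSeries g)) : f = g := by
  ext n
  exact coeff_eq_of_coeff_ghostSeries_eq hf hg (fun n _ => h n) n le_rfl

theorem coeff_ghostSeries_eq_of_coeff_eq (hf : constantCoeff f = 1) (hg : constantCoeff g = 1)
    {N : ℕ} (h : ∀ n ≤ N, coeff n f = coeff n g) :
    ∀ n ≤ N, coeff n (ghostSeries f) = coeff n (ghostSeries g) := by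
  have hdvd : X ^ (N + 1) ∣ f - g :=
    X_pow_dvd_iff.2 fun n hn => by rw [map_sub, h n (Nat.lt_succ_iff.1 hn), sub_self]
  have hderiv : X ^ (N + 1) ∣ X * derivative R (f - g) := X_pow_dvd_iff.2 fun n hn => by
    rw [coeff_X_mul_derivative, X_pow_dvd_iff.1 hdvd n hn, mul_zero]
  have hghost : X ^ (N + 1) ∣ evalNegHom (ghostSeries f - ghostSeries g) * f := by
    have hident : evalNegHom (ghostSeries f - ghostSeries g) * f =
        -(X * derivative R (f - g) + (f - g) * evalNegHom (ghostSeries g)) := by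
      rw [map_sub, map_sub]
      linear_combination X_mul_derivative_eq hf - X_mul_derivative_eq hg
    rw [hident]
    exact ((hderiv.add (hdvd.mul_right _)).neg_right)
  have hunit : IsUnit f := isUnit_iff_constantCoeff.2 (by rw [hf]; exact isUnit_one)
  intro n hn
  have hcoeff := X_pow_dvd_iff.1 (hunit.dvd_mul_right.1 hghost) n (Nat.lt_succ_of_le hn)
  rw [coeff_evalNegHom] at hcoeff
  exact sub_eq_zero.1 (by simpa using hcoeff)

end GhostSeries

section LinearProd

open PowerSeries Finset

variable {R : Type*} [CommRing R] {ι : Type*} [Fintype ι]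

/-- The power series `∏ (1 + x_i t)`. -/
noncomputable def linearProd (x : ι → R) : R⟦X⟧ := ∏ i, (1 + C (x i) * X)

theorem constantCoeff_linearProd (x : ι → R) : constantCoeff (linearProd x) = 1 := by
  simp [linearProd, map_prod]

theorem map_linearProd {S : Type*} [CommRing S] (φ : R →+* S) (x : ι → R) :
    map φ (linearProd x) = linearProd (φ ∘ x) := by
  simp [linearProd, map_prod]

theorem coeff_ghostSeries_linearProd (x : ι → R) {n : ℕ} (hn : n ≠ 0) :
    coeff n (ghostSeries (linearProd x)) = ∑ i, x i ^ n := by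
  rw [linearProd, ghostSeries_prod _ _ fun i => by simp, map_sum]
  exact sum_congr rfl fun i _ => coeff_ghostSeries_one_add_C_mul_X _ hn

theorem coeff_linearProd (x : ι → R) (n : ℕ) :
    coeff n (linearProd x) = ∑ s ∈ powersetCard n univ, ∏ i ∈ s, x i := by
  classical
  have hcoeff (s : Finset ι) :
      coeff n (∏ i ∈ s, (C (x i) * X : R⟦X⟧)) = if #s = n then ∏ i ∈ s, x i else 0 := by
    rw [prod_mul_distrib, prod_const, ← map_prod, coeff_C_mul, coeff_X_pow]
    simp [eq_comm]
  rw [linearProd, prod_one_add, map_sum, powersetCard_eq_filter, sum_filter]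
  exact sum_congr rfl fun s _ => hcoeff s

theorem coeff_linearProd_eq_aeval_esymm (x : ι → R) (n : ℕ) :
    coeff n (linearProd x) = MvPolynomial.aeval x (MvPolynomial.esymm ι ℤ n) := by
  simp [coeff_linearProd, MvPolynomial.esymm]

theorem coeff_ghostSeries_of_coeff_eq_linearProd {f : R⟦X⟧} (hf : constantCoeff f = 1)
    {x : ι → R} {N : ℕ} (hx : ∀ n ≤ N, coeff n f = coeff n (linearProd x)) {n : ℕ} (hn : n ≤ N)
    (hn0 : n ≠ 0) : coeff n (ghostSeries f) = ∑ i, x i ^ n := by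
  rw [coeff_ghostSeries_eq_of_coeff_eq hf (constantCoeff_linearProd x) hx n hn,
    coeff_ghostSeries_linearProd x hn0]

end LinearProd

section SplittingPrinciple

open PowerSeries

-- The `x_i` come from the linear factors of the reversed truncation, which is monic of degree `N`.
theorem exists_free_map_eq_linearProd {R : Type u} [CommRing R] [Nontrivial R] {f : R⟦X⟧}
    (hf : constantCoeff f = 1) (N : ℕ) :
    ∃ (S : Type u) (_ : CommRing S) (_ : Nontrivial S) (_ : Algebra R S) (_ : Module.Free R S)
      (x : Fin N → S), ∀ n ≤ N, coeff n (map (algebraMap R S) f) = coeff n (linearProd x) := by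
  let p : Polynomial R := (trunc (N + 1) f).reflect N
  have hcoeff : ∀ n ≤ N, p.coeff (N - n) = coeff n f := fun n hn => by
    rw [Polynomial.coeff_reflect, Polynomial.revAt_le (Nat.sub_le N n), Nat.sub_sub_self hn,
      coeff_trunc, if_pos (Nat.lt_succ_of_le hn)]
  have hp : p.IsMonicOfDegree N := by
    rw [Polynomial.isMonicOfDegree_iff]
    refine ⟨Polynomial.natDegree_le_iff_coeff_eq_zero.2 fun n hn => ?_, ?_⟩
    · rw [Polynomial.coeff_reflect, Polynomial.revAt_eq_self_of_lt hn, coeff_trunc,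
        if_neg (by omega)]
    · simpa [hf] using hcoeff 0 (Nat.zero_le N)
  obtain ⟨S, _, _, _, _, _, hsplits⟩ := hp.monic.exists_splits_map
  obtain ⟨l, hl⟩ : ∃ l : List S,
      p.map (algebraMap R S) = ((l : Multiset S).map (Polynomial.X + Polynomial.C ·)).prod := by
    obtain ⟨m, hm⟩ := Polynomial.splits_iff_exists_multiset'.1 hsplits
    obtain ⟨l, rfl⟩ := Quot.exists_rep m
    exact ⟨l, by simpa [hp.monic.map _ |>.leadingCoeff] using hm⟩
  obtain rfl : l.length = N := by
    rw [← hp.natDegree_eq, ← hp.monic.natDegree_map (algebraMap R S), hl,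
      Polynomial.natDegree_multiset_prod_of_monic]
    · simp [Function.comp_def]
    · simp [Polynomial.monic_X_add_C]
  refine ⟨S, ‹_›, ‹_›, ‹_›, ‹_›, l.get, fun n hn => ?_⟩
  rw [coeff_map, ← hcoeff n hn, ← Polynomial.coeff_map, hl,
    Multiset.prod_X_add_C_coeff _ (by simp), coeff_linearProd, ← Finset.esymm_map_val]
  simp [Nat.sub_sub_self hn]

theorem exists_injective_map_eq_linearProd {R : Type u} [CommRing R] [IsAddTorsionFree R]
    {f : R⟦X⟧} (hf : constantCoeff f = 1) (N : ℕ) :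
    ∃ (S : Type u) (_ : CommRing S) (_ : IsAddTorsionFree S) (φ : R →+* S) (x : Fin N → S),
      Function.Injective φ ∧ ∀ n ≤ N, coeff n (map φ f) = coeff n (linearProd x) := by
  rcases subsingleton_or_nontrivial R with _ | _
  · exact ⟨R, inferInstance, inferInstance, .id R, 0, Function.injective_id,
      fun _ _ => Subsingleton.elim _ _⟩
  obtain ⟨S, _, _, _, _, x, hx⟩ := exists_free_map_eq_linearProd hf N
  have : IsAddTorsionFree S :=
    Function.Injective.isAddTorsionFree (Module.Free.chooseBasis R S).repr.toAddMonoidHom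
      (Module.Free.chooseBasis R S).repr.injective
  exact ⟨S, inferInstance, this, algebraMap R S, x, FaithfulSMul.algebraMap_injective R S, hx⟩

end SplittingPrinciple

namespace UniversalPoly

open MvPolynomial

theorem aeval_mulPoly (n : ℕ) :
    aeval (Sum.elim
      (fun i : Fin n => rename Sum.inl (esymm (Fin n) ℤ (i + 1)))
      (fun i : Fin n => rename Sum.inr (esymm (Fin n) ℤ (i + 1)))) (mulPoly n) =
      esymmProducts n :=
  (exists_mulPoly n).choose_spec

theorem aeval_lamPoly (m k : ℕ) :
    aeval (fun i : Fin (m * k) => esymm (Fin (m * k)) ℤ (i + 1)) (lamPoly m k) =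
      esymmSubsets m k :=
  (exists_lamPoly m k).choose_spec

end UniversalPoly

namespace LambdaStructure

open PowerSeries Finset

section Witt

variable {R S : Type*} [CommRing R] [CommRing S]

theorem map_wittMul (φ : R →+* S) (f g : R⟦X⟧) :
    map φ (wittMul f g) = wittMul (map φ f) (map φ g) := by
  have hφ : ∀ a, φ a = φ.toIntAlgHom a := fun _ => rfl
  ext n
  rw [coeff_map, wittMul, wittMul, coeff_mk, coeff_mk, hφ, ← AlgHom.comp_apply,
    MvPolynomial.comp_aeval]
  congr 2
  ext1 i
  cases i <;> simp

theorem map_wittLam (φ : R →+* S) (k : ℕ) (f : R⟦X⟧) :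
    map φ (wittLam k f) = wittLam k (map φ f) := by
  have hφ : ∀ a, φ a = φ.toIntAlgHom a := fun _ => rfl
  ext n
  rw [coeff_map, wittLam, wittLam, coeff_mk, coeff_mk, hφ, ← AlgHom.comp_apply,
    MvPolynomial.comp_aeval]
  congr 2

theorem coeff_wittMul_of_linearProd {n : ℕ} {f g : R⟦X⟧} {x y : Fin n → R}
    (hf : ∀ i ≤ n, coeff i f = coeff i (linearProd x))
    (hg : ∀ i ≤ n, coeff i g = coeff i (linearProd y)) :
    coeff n (wittMul f g) = coeff n (linearProd fun p : Fin n × Fin n => x p.1 * y p.2) := by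
  have h := congrArg (MvPolynomial.aeval (Sum.elim x y)) (UniversalPoly.aeval_mulPoly n)
  rw [UniversalPoly.esymmProducts, ← AlgHom.comp_apply, ← AlgHom.comp_apply,
    MvPolynomial.comp_aeval, MvPolynomial.comp_aeval] at h
  rw [wittMul, coeff_mk, coeff_linearProd_eq_aeval_esymm]
  convert! h using 2
  · congr 1
    ext1 i
    rcases i with i | i
    · simp [hf (i + 1) (by omega), coeff_linearProd_eq_aeval_esymm, MvPolynomial.aeval_rename]
    · simp [hg (i + 1) (by omega), coeff_linearProd_eq_aeval_esymm, MvPolynomial.aeval_rename]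
  · simp

theorem coeff_wittLam_of_linearProd {m k : ℕ} {f : R⟦X⟧} {x : Fin (m * k) → R}
    (hf : ∀ i ≤ m * k, coeff i f = coeff i (linearProd x)) :
    coeff m (wittLam k f) =
      coeff m (linearProd fun s : {s : Finset (Fin (m * k)) // #s = k} => ∏ i ∈ s.1, x i) := by
  have h := congrArg (MvPolynomial.aeval x) (UniversalPoly.aeval_lamPoly m k)
  rw [UniversalPoly.esymmSubsets, ← AlgHom.comp_apply, ← AlgHom.comp_apply,
    MvPolynomial.comp_aeval, MvPolynomial.comp_aeval] at h
  rw [wittLam, coeff_mk, coeff_linearProd_eq_aeval_esymm]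
  convert! h using 2
  · congr 1
    ext1 i
    simp [hf (i + 1) (by omega), coeff_linearProd_eq_aeval_esymm]
  · simp

end Witt

section TorsionFree

variable {R : Type u} [CommRing R] [IsAddTorsionFree R] {f g h : R⟦X⟧}

theorem eq_wittMul_of_coeff_ghostSeries (hf : constantCoeff f = 1) (hg : constantCoeff g = 1)
    (hh : constantCoeff h = 1) (hmul : ∀ n, n ≠ 0 →
      coeff n (ghostSeries h) = coeff n (ghostSeries f) * coeff n (ghostSeries g)) :
    h = wittMul f g := by
  ext n
  obtain ⟨S, _, _, φ, x, hφ, hx⟩ := exists_injective_map_eq_linearProd hf n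
  obtain ⟨T, _, _, χ, y, hχ, hy⟩ :=
    exists_injective_map_eq_linearProd (constantCoeff_map_eq_one φ hg) n
  replace hx : ∀ i ≤ n, coeff i (map χ (map φ f)) = coeff i (linearProd (χ ∘ x)) := fun i hi => by
    rw [coeff_map, hx i hi, ← coeff_map, map_linearProd]
  apply (hχ.comp hφ)
  simp only [Function.comp_apply, ← coeff_map]
  rw [map_wittMul, map_wittMul, coeff_wittMul_of_linearProd hx hy]
  refine coeff_eq_of_coeff_ghostSeries_eq
    (constantCoeff_map_eq_one χ (constantCoeff_map_eq_one φ hh)) (constantCoeff_linearProd _)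
    (fun m hm hm0 => ?_) n le_rfl
  have hf' := constantCoeff_map_eq_one φ hf
  have hg' := constantCoeff_map_eq_one φ hg
  have hh' := constantCoeff_map_eq_one φ hh
  calc coeff m (ghostSeries (map χ (map φ h)))
      = coeff m (ghostSeries (map χ (map φ f))) * coeff m (ghostSeries (map χ (map φ g))) := by
        simp only [← map_ghostSeries χ hf', ← map_ghostSeries χ hg', ← map_ghostSeries χ hh',
          ← map_ghostSeries φ hf, ← map_ghostSeries φ hg, ← map_ghostSeries φ hh, coeff_map,
          hmul m hm0, map_mul]
    _ = (∑ i, (χ ∘ x) i ^ m) * ∑ j, y j ^ m := by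
        rw [coeff_ghostSeries_of_coeff_eq_linearProd (constantCoeff_map_eq_one χ hf') hx hm hm0,
          coeff_ghostSeries_of_coeff_eq_linearProd (constantCoeff_map_eq_one χ hg') hy hm hm0]
    _ = coeff m (ghostSeries (linearProd fun p : Fin n × Fin n => (χ ∘ x) p.1 * y p.2)) := by
        simp only [coeff_ghostSeries_linearProd _ hm0, sum_mul_sum, Fintype.sum_prod_type, mul_pow]

-- If `f = ∏ (1 + x_i t)`, then `g n = ∏ (1 + x_i ^ n t)`.
theorem eq_wittLam_of_coeff_ghostSeries {k : ℕ} {g : ℕ → R⟦X⟧} (hf : constantCoeff f = 1)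
    (hg : ∀ n, constantCoeff (g n) = 1) (hh : constantCoeff h = 1)
    (hadams : ∀ n i, n ≠ 0 → i ≠ 0 →
      coeff i (ghostSeries (g n)) = coeff (i * n) (ghostSeries f))
    (hlam : ∀ n, n ≠ 0 → coeff n (ghostSeries h) = coeff k (g n)) :
    h = wittLam k f := by
  ext m
  obtain ⟨S, _, _, φ, x, hφ, hx⟩ := exists_injective_map_eq_linearProd hf (m * k)
  apply hφ
  rw [← coeff_map, ← coeff_map, map_wittLam, coeff_wittLam_of_linearProd hx]
  refine coeff_eq_of_coeff_ghostSeries_eq (constantCoeff_map_eq_one φ hh)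
    (constantCoeff_linearProd _) (fun n hn hn0 => ?_) m le_rfl
  have hgn : coeff k (map φ (g n)) = coeff k (linearProd fun i => x i ^ n) := by
    refine coeff_eq_of_coeff_ghostSeries_eq (constantCoeff_map_eq_one φ (hg n))
      (constantCoeff_linearProd _) (fun i hi hi0 => ?_) k le_rfl
    have hle : i * n ≤ m * k := by rw [mul_comm]; exact Nat.mul_le_mul hn hi
    rw [← map_ghostSeries φ (hg n), coeff_map, hadams n i hn0 hi0, ← coeff_map,
      map_ghostSeries φ hf, coeff_ghostSeries_of_coeff_eq_linearProd
        (constantCoeff_map_eq_one φ hf) hx hle (Nat.mul_ne_zero hi0 hn0),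
      coeff_ghostSeries_linearProd _ hi0]
    simp only [← pow_mul, mul_comm]
  rw [← map_ghostSeries φ hh, coeff_map, hlam n hn0, ← coeff_map, hgn, coeff_linearProd,
    coeff_ghostSeries_linearProd _ hn0]
  simp only [← prod_pow]
  exact sum_subtype (p := fun s => #s = k) (F := inferInstance) _ (by simp) _

end TorsionFree

variable {R S : Type*} [CommRing R] [CommRing S] (L : LambdaStructure R) (M : LambdaStructure S)

theorem constantCoeff_series (r : R) : constantCoeff (L.series r) = 1 := by
  rw [← coeff_zero_eq_constantCoeff_apply, L.coeff_zero]

theorem coeff_ghostSeries_series (n : ℕ) (r : R) :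
    coeff n (ghostSeries (L.series r)) = L.adams n r := rfl

theorem lam_zero (r : R) : L.lam 0 r = 1 := L.coeff_zero r

theorem lam_one (r : R) : L.lam 1 r = r := L.coeff_one r

theorem adams_zero (r : R) : L.adams 0 r = 0 := coeff_zero_ghostSeries _

theorem series_zero : L.series 0 = 1 := by
  have hunit : IsUnit (L.series 0) :=
    isUnit_iff_constantCoeff.2 (by rw [L.constantCoeff_series]; exact isUnit_one)
  apply hunit.mul_left_cancel
  rw [← L.series_add, add_zero, mul_one]

theorem adams_add (n : ℕ) (r s : R) : L.adams n (r + s) = L.adams n r + L.adams n s := by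
  simp only [← coeff_ghostSeries_series, L.series_add,
    ghostSeries_mul (L.constantCoeff_series r) (L.constantCoeff_series s), map_add]

theorem nsmul_lam (n : ℕ) (r : R) :
    n • L.lam n r =
      -∑ p ∈ antidiagonal n, (-1) ^ p.1 * L.adams p.1 r * L.lam p.2 r := by
  rw [nsmul_eq_mul]
  exact (ghostSeries_eq_iff_newton (L.constantCoeff_series r)).1 rfl n

variable {L M}

theorem map_series_of_adams [IsAddTorsionFree S] (φ : R →+* S) {r : R} {s : S}
    (h : ∀ n, n ≠ 0 → φ (L.adams n r) = M.adams n s) :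
    map φ (L.series r) = M.series s := by
  have hL := L.constantCoeff_series r
  refine eq_of_coeff_ghostSeries_eq (constantCoeff_map_eq_one φ hL) (M.constantCoeff_series s)
    fun n hn => ?_
  rw [← map_ghostSeries φ hL, coeff_map]
  exact h n hn

theorem map_lam_of_adams [IsAddTorsionFree S] (φ : R →+* S) {r : R} {s : S}
    (h : ∀ n, n ≠ 0 → φ (L.adams n r) = M.adams n s) (k : ℕ) :
    φ (L.lam k r) = M.lam k s := by
  rw [lam, lam, ← map_series_of_adams φ h, coeff_map]

/-- Wilkerson's criterion. -/
theorem isSpecial_of_adams [IsAddTorsionFree R] (hone : ∀ n, n ≠ 0 → L.adams n 1 = 1)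
    (hmul : ∀ n, n ≠ 0 → ∀ r s, L.adams n (r * s) = L.adams n r * L.adams n s)
    (hcomp : ∀ m n, m ≠ 0 → n ≠ 0 → ∀ r, L.adams m (L.adams n r) = L.adams (m * n) r) :
    L.IsSpecial where
  series_one := by
    have hX : (1 + X : R⟦X⟧) = 1 + C 1 * X := by rw [map_one, one_mul]
    rw [hX]
    refine eq_of_coeff_ghostSeries_eq (L.constantCoeff_series 1) (by simp) fun n hn => ?_
    rw [coeff_ghostSeries_one_add_C_mul_X _ hn, coeff_ghostSeries_series, hone n hn, one_pow]
  series_mul r s := eq_wittMul_of_coeff_ghostSeries (L.constantCoeff_series r)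
    (L.constantCoeff_series s) (L.constantCoeff_series _) fun n hn => hmul n hn r s
  series_lam k r := by
    refine eq_wittLam_of_coeff_ghostSeries (g := fun n => L.series (L.adams n r))
      (L.constantCoeff_series r) (fun _ => L.constantCoeff_series _) (L.constantCoeff_series _)
      (fun n i hn hi => hcomp i n hi hn r) fun n hn => ?_
    let ψ : R →+* R :=
      RingHom.mk' ⟨⟨L.adams n, hone n hn⟩, hmul n hn⟩ (L.adams_add n)
    refine map_lam_of_adams (M := L) ψ (fun i hi => ?_) k
    change L.adams n (L.adams i r) = L.adams i (L.adams n r)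
    rw [hcomp n i hn hi, hcomp i n hi hn, mul_comm]

theorem lam_mem_of_adams_mem (𝒜 : ℕ → AddSubgroup R) [SetLike.GradedMonoid 𝒜]
    (hsat : ∀ d n, n ≠ 0 → ∀ r, n • r ∈ 𝒜 d → r ∈ 𝒜 d) {d : ℕ} {r : R}
    (hadams : ∀ n, n ≠ 0 → L.adams n r ∈ 𝒜 (n * d)) (n : ℕ) : L.lam n r ∈ 𝒜 (n * d) := by
  induction n using Nat.strong_induction_on with
  | _ n ih =>
    rcases eq_or_ne n 0 with rfl | hn
    · rw [lam_zero, zero_mul]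
      exact SetLike.GradedOne.one_mem
    refine hsat _ n hn _ ?_
    rw [nsmul_lam]
    refine neg_mem (sum_mem fun p hp => ?_)
    rw [HasAntidiagonal.mem_antidiagonal] at hp
    rw [mul_assoc]
    rcases eq_or_ne p.1 0 with hp0 | hp0
    · simp [hp0, adams_zero]
    have hmem : L.adams p.1 r * L.lam p.2 r ∈ 𝒜 (n * d) := by
      rw [← hp, add_mul]
      exact SetLike.GradedMul.mul_mem (hadams _ hp0) (ih p.2 (by omega))
    rcases neg_one_pow_eq_or R p.1 with h1 | h1 <;> rw [h1]
    · rwa [one_mul]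
    · rw [neg_one_mul]
      exact neg_mem hmem

/-- The `λ`-structure on a subring that is stable under the operations `λ_n`. -/
noncomputable def restrict (L : LambdaStructure R) (T : Subring R)
    (hT : ∀ n, ∀ r ∈ T, L.lam n r ∈ T) : LambdaStructure T where
  series r := PowerSeries.mk fun n => (⟨L.lam n r, hT n r r.2⟩ : T)
  coeff_zero r := Subtype.ext (by rw [coeff_mk]; exact L.lam_zero r)
  coeff_one r := Subtype.ext (by rw [coeff_mk]; exact L.lam_one r)
  series_add r s := by
    have hmap (r : T) :
        map T.subtype (PowerSeries.mk fun n => (⟨L.lam n r, hT n r r.2⟩ : T)) = L.series r := by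
      ext n
      rw [coeff_map, coeff_mk]
      rfl
    apply map_injective T.subtype Subtype.val_injective
    rw [map_mul, hmap, hmap, hmap]
    exact L.series_add r s

theorem coe_lam_restrict {T : Subring R} (hT : ∀ n, ∀ r ∈ T, L.lam n r ∈ T) (n : ℕ) (r : T) :
    ((L.restrict T hT).lam n r : R) = L.lam n r := by
  rw [lam, restrict, coeff_mk]

theorem coe_adams_restrict {T : Subring R} (hT : ∀ n, ∀ r ∈ T, L.lam n r ∈ T) (n : ℕ) (r : T) :
    ((L.restrict T hT).adams n r : R) = L.adams n r := by
  have hmap : map T.subtype ((L.restrict T hT).series r) = L.series r := by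
    ext k
    rw [coeff_map]
    exact coe_lam_restrict hT k r
  rw [← coeff_ghostSeries_series, ← coeff_ghostSeries_series, ← hmap,
    ← map_ghostSeries T.subtype (constantCoeff_series _ r), coeff_map]
  rfl

end LambdaStructure

section Expand

open MvPowerSeries

variable {σ τ R : Type*} [CommRing R]

theorem exists_of_coeff_expand_ne_zero {n : ℕ} {hn : n ≠ 0} {f : MvPowerSeries σ R} {m : σ →₀ ℕ}
    (hm : coeff m (expand n hn f) ≠ 0) : ∃ k, m = n • k ∧ coeff k f ≠ 0 := by
  obtain ⟨k, hk, rfl⟩ := support_expand_subset n hn f hm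
  exact ⟨k, rfl, hk⟩

theorem expand_rename (n : ℕ) (hn : n ≠ 0) (e : σ → τ) [Filter.TendstoCofinite e]
    (f : MvPowerSeries σ R) : expand n hn (rename e f) = rename e (expand n hn f) := by
  rw [rename_eq_subst, rename_eq_subst, expand_subst n hn (HasSubst.X_comp e), expand, expand,
    substAlgHom_apply, subst_comp_subst_apply (HasSubst.X_pow hn) (HasSubst.X_comp e)]
  congr 1
  ext1 i
  rw [subst_pow (HasSubst.X_comp e), subst_X (HasSubst.X_comp e), substAlgHom_apply]
  simp [subst_X (HasSubst.X_pow hn)]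

end Expand

section CutoffIdeal

open MvPowerSeries

variable {σ : Type*} {R : Type*} [CommRing R] {f : MvPowerSeries σ R} {μ : σ →₀ ℕ}

/-- The ideal of power series without monomials dividing `x ^ μ`. Congruence modulo all these
ideals is equality, and each of them only sees finitely many coefficients. -/
def cutoffIdeal (R : Type*) [CommRing R] (μ : σ →₀ ℕ) : Ideal (MvPowerSeries σ R) where
  carrier := {f | ∀ κ ≤ μ, coeff κ f = 0}
  zero_mem' _ _ := map_zero _
  add_mem' hf hg κ hκ := by rw [map_add, hf κ hκ, hg κ hκ, add_zero]
  smul_mem' c f hf κ hκ := by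
    classical
    rw [smul_eq_mul, coeff_mul]
    refine Finset.sum_eq_zero fun p hp => ?_
    rw [Finset.HasAntidiagonal.mem_antidiagonal] at hp
    rw [hf p.2 (le_trans (hp ▸ le_add_self) hκ), mul_zero]

theorem sub_trunc'_mem_cutoffIdeal [DecidableEq σ] (f : MvPowerSeries σ R) {ν : σ →₀ ℕ}
    (h : μ ≤ ν) : f - trunc' R ν f ∈ cutoffIdeal R μ := fun κ hκ => by
  rw [map_sub, MvPolynomial.coeff_coe, coeff_trunc', if_pos (hκ.trans h), sub_self]

theorem expand_mem_cutoffIdeal (hf : f ∈ cutoffIdeal R μ) (n : ℕ) (hn : n ≠ 0) :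
    expand n hn f ∈ cutoffIdeal R μ := by
  intro κ hκ
  by_contra h
  obtain ⟨k, rfl, hk⟩ := exists_of_coeff_expand_ne_zero h
  exact hk (hf k ((le_self_nsmul zero_le hn).trans hκ))

instance [IsAddTorsionFree R] : IsAddTorsionFree (MvPowerSeries σ R) :=
  inferInstanceAs (IsAddTorsionFree ((σ →₀ ℕ) → R))

instance [IsAddTorsionFree R] : IsAddTorsionFree (MvPowerSeries σ R ⧸ cutoffIdeal R μ) where
  nsmul_right_injective n hn := by
    intro a b hab
    obtain ⟨f, rfl⟩ := Ideal.Quotient.mk_surjective a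
    obtain ⟨g, rfl⟩ := Ideal.Quotient.mk_surjective b
    simp only [← map_nsmul, Ideal.Quotient.eq, ← nsmul_sub] at hab
    refine Ideal.Quotient.eq.2 fun κ hκ => nsmul_right_injective hn ?_
    simpa only [map_nsmul, nsmul_zero] using hab κ hκ

theorem eq_of_forall_mk_cutoffIdeal_eq {f g : MvPowerSeries σ R}
    (h : ∀ μ, Ideal.Quotient.mk (cutoffIdeal R μ) f = Ideal.Quotient.mk (cutoffIdeal R μ) g) :
    f = g := by
  ext μ
  rw [← sub_eq_zero, ← map_sub]
  exact Ideal.Quotient.eq.1 (h μ) μ le_rfl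

theorem exists_map_mk_cutoffIdeal_eq (G : (σ →₀ ℕ) → (MvPowerSeries σ R)⟦X⟧)
    (hG : ∀ κ μ, κ ≤ μ → PowerSeries.map (Ideal.Quotient.mk (cutoffIdeal R κ)) (G κ) =
      PowerSeries.map (Ideal.Quotient.mk (cutoffIdeal R κ)) (G μ)) :
    ∃ F : (MvPowerSeries σ R)⟦X⟧, ∀ μ,
      PowerSeries.map (Ideal.Quotient.mk (cutoffIdeal R μ)) F =
        PowerSeries.map (Ideal.Quotient.mk (cutoffIdeal R μ)) (G μ) := by
  let c (n : ℕ) : MvPowerSeries σ R := fun κ => coeff κ (PowerSeries.coeff n (G κ))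
  refine ⟨PowerSeries.mk c, fun μ => ?_⟩
  ext n
  rw [PowerSeries.coeff_map, PowerSeries.coeff_map, PowerSeries.coeff_mk, Ideal.Quotient.eq]
  intro κ hκ
  have hn := congrArg (PowerSeries.coeff n) (hG κ μ hκ)
  rw [PowerSeries.coeff_map, PowerSeries.coeff_map, Ideal.Quotient.eq] at hn
  have hcoeff := hn κ le_rfl
  rw [map_sub] at hcoeff ⊢
  exact hcoeff

end CutoffIdeal

section LambdaSeries

open MvPowerSeries

variable {σ : Type*} {f g : MvPowerSeries σ ℤ} {F G : (MvPowerSeries σ ℤ)⟦X⟧}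

/-- `F` is the series `λ_t(f)` for the `λ`-structure whose Adams operations are
`ψ_n f = f(x ^ n)`. -/
structure IsLambdaSeries (f : MvPowerSeries σ ℤ) (F : (MvPowerSeries σ ℤ)⟦X⟧) : Prop where
  constantCoeff_eq_one : PowerSeries.constantCoeff F = 1
  coeff_ghostSeries : ∀ n (hn : n ≠ 0), PowerSeries.coeff n (ghostSeries F) = expand n hn f

namespace IsLambdaSeries

theorem coeff_one (hF : IsLambdaSeries f F) : PowerSeries.coeff 1 F = f := by
  have h := (ghostSeries_eq_iff_newton hF.constantCoeff_eq_one).1 rfl 1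
  rw [Finset.Nat.antidiagonal_succ] at h
  simpa [hF.constantCoeff_eq_one, coeff_zero_ghostSeries, hF.coeff_ghostSeries] using h

protected theorem zero : IsLambdaSeries (0 : MvPowerSeries σ ℤ) 1 where
  constantCoeff_eq_one := map_one _
  coeff_ghostSeries n hn := by rw [ghostSeries_one, map_zero, map_zero]

protected theorem add (hF : IsLambdaSeries f F) (hG : IsLambdaSeries g G) :
    IsLambdaSeries (f + g) (F * G) where
  constantCoeff_eq_one := by
    rw [map_mul, hF.constantCoeff_eq_one, hG.constantCoeff_eq_one, one_mul]
  coeff_ghostSeries n hn := by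
    rw [ghostSeries_mul hF.constantCoeff_eq_one hG.constantCoeff_eq_one, map_add,
      hF.coeff_ghostSeries n hn, hG.coeff_ghostSeries n hn, map_add]

protected theorem neg (hF : IsLambdaSeries f F) :
    IsLambdaSeries (-f) (PowerSeries.invOfUnit F 1) := by
  have hone : PowerSeries.constantCoeff (PowerSeries.invOfUnit F 1) = 1 := by simp
  refine ⟨hone, fun n hn => ?_⟩
  have hsum : ghostSeries F + ghostSeries (PowerSeries.invOfUnit F 1) = 0 := by
    rw [← ghostSeries_mul hF.constantCoeff_eq_one hone,
      PowerSeries.mul_invOfUnit _ _ (by simp [hF.constantCoeff_eq_one]), ghostSeries_one]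
  rw [eq_neg_of_add_eq_zero_right hsum, map_neg, hF.coeff_ghostSeries n hn, map_neg]

protected theorem monomial (m : σ →₀ ℕ) :
    IsLambdaSeries (monomial m (1 : ℤ))
      (1 + PowerSeries.C (monomial m (1 : ℤ)) * PowerSeries.X) where
  constantCoeff_eq_one := by simp
  coeff_ghostSeries n hn := by
    rw [coeff_ghostSeries_one_add_C_mul_X _ hn, expand_monomial, monomial_pow, one_pow]

theorem exists_coe (p : MvPolynomial σ ℤ) : ∃ F, IsLambdaSeries (p : MvPowerSeries σ ℤ) F := by
  induction p using MvPolynomial.induction_on' with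
  | monomial m a =>
    rw [MvPolynomial.coe_monomial]
    induction a using Int.induction_on with
    | zero => exact ⟨1, by rw [map_zero]; exact .zero⟩
    | succ a ih =>
      obtain ⟨F, hF⟩ := ih
      exact ⟨_, by rw [map_add]; exact hF.add (.monomial m)⟩
    | pred a ih =>
      obtain ⟨F, hF⟩ := ih
      exact ⟨_, by rw [map_sub, sub_eq_add_neg]; exact hF.add (IsLambdaSeries.monomial m).neg⟩
  | add p q hp hq =>
    obtain ⟨F, hF⟩ := hp
    obtain ⟨G, hG⟩ := hq
    exact ⟨F * G, by rw [MvPolynomial.coe_add]; exact hF.add hG⟩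

theorem map_mk_eq {μ : σ →₀ ℕ} (hF : IsLambdaSeries f F) (hG : IsLambdaSeries g G)
    (h : f - g ∈ cutoffIdeal ℤ μ) :
    PowerSeries.map (Ideal.Quotient.mk (cutoffIdeal ℤ μ)) F =
      PowerSeries.map (Ideal.Quotient.mk (cutoffIdeal ℤ μ)) G := by
  refine eq_of_coeff_ghostSeries_eq (constantCoeff_map_eq_one _ hF.constantCoeff_eq_one)
    (constantCoeff_map_eq_one _ hG.constantCoeff_eq_one) fun n hn => ?_
  rw [← map_ghostSeries _ hF.constantCoeff_eq_one, ← map_ghostSeries _ hG.constantCoeff_eq_one,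
    PowerSeries.coeff_map, PowerSeries.coeff_map, hF.coeff_ghostSeries n hn,
    hG.coeff_ghostSeries n hn, Ideal.Quotient.eq, ← map_sub]
  exact expand_mem_cutoffIdeal h n hn

theorem unique (hF : IsLambdaSeries f F) (hG : IsLambdaSeries f G) : F = G :=
  eq_of_coeff_ghostSeries_eq hF.constantCoeff_eq_one hG.constantCoeff_eq_one fun n hn => by
    rw [hF.coeff_ghostSeries n hn, hG.coeff_ghostSeries n hn]

end IsLambdaSeries

-- `F` is glued from the series of the truncations of `f`.
theorem exists_isLambdaSeries (f : MvPowerSeries σ ℤ) : ∃ F, IsLambdaSeries f F := by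
  classical
  choose G hG using fun μ => IsLambdaSeries.exists_coe (trunc' ℤ μ f)
  obtain ⟨F, hF⟩ := exists_map_mk_cutoffIdeal_eq G fun κ μ hκ => (hG κ).map_mk_eq (hG μ) <| by
    simpa using sub_mem (sub_trunc'_mem_cutoffIdeal f hκ) (sub_trunc'_mem_cutoffIdeal f le_rfl)
  have hF1 : PowerSeries.constantCoeff F = 1 := eq_of_forall_mk_cutoffIdeal_eq fun μ => by
    rw [← PowerSeries.coeff_zero_eq_constantCoeff_apply, ← PowerSeries.coeff_map, hF,
      PowerSeries.coeff_map, PowerSeries.coeff_zero_eq_constantCoeff_apply,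
      (hG μ).constantCoeff_eq_one]
  refine ⟨F, hF1, fun n hn => eq_of_forall_mk_cutoffIdeal_eq fun μ => ?_⟩
  rw [← PowerSeries.coeff_map, map_ghostSeries _ hF1, hF,
    ← map_ghostSeries _ (hG μ).constantCoeff_eq_one, PowerSeries.coeff_map,
    (hG μ).coeff_ghostSeries n hn, eq_comm, Ideal.Quotient.eq, ← map_sub]
  exact expand_mem_cutoffIdeal (sub_trunc'_mem_cutoffIdeal f le_rfl) n hn

/-- The `λ`-structure on power series with integer coefficients in which `λ_t` of a monomial
`m` is `1 + m t`. -/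
noncomputable def powerSeriesLambda (σ : Type*) : LambdaStructure (MvPowerSeries σ ℤ) where
  series f := (exists_isLambdaSeries f).choose
  coeff_zero f := by
    rw [PowerSeries.coeff_zero_eq_constantCoeff_apply]
    exact (exists_isLambdaSeries f).choose_spec.constantCoeff_eq_one
  coeff_one f := (exists_isLambdaSeries f).choose_spec.coeff_one
  series_add f g := (exists_isLambdaSeries (f + g)).choose_spec.unique
    ((exists_isLambdaSeries f).choose_spec.add (exists_isLambdaSeries g).choose_spec)

theorem isLambdaSeries_series (f : MvPowerSeries σ ℤ) :
    IsLambdaSeries f ((powerSeriesLambda σ).series f) :=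
  (exists_isLambdaSeries f).choose_spec

theorem adams_powerSeriesLambda {n : ℕ} (hn : n ≠ 0) (f : MvPowerSeries σ ℤ) :
    (powerSeriesLambda σ).adams n f = expand n hn f :=
  (isLambdaSeries_series f).coeff_ghostSeries n hn

end LambdaSeries

section BoundedInvariants

open MvPowerSeries

variable {σ : Type*} (w : σ → ℕ)

instance : IsAddTorsionFree (boundedInvariants w) :=
  Function.Injective.isAddTorsionFree (boundedInvariants w).subtype.toAddMonoidHom
    Subtype.val_injective

variable {w}

theorem expand_mem_boundedInvariants {f : MvPowerSeries σ ℤ} (hf : f ∈ boundedInvariants w)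
    (n : ℕ) (hn : n ≠ 0) : expand n hn f ∈ boundedInvariants w := by
  obtain ⟨⟨N, hN⟩, hinv⟩ := hf
  refine ⟨⟨n * N, fun m hm => ?_⟩, fun g hg => ?_⟩
  · obtain ⟨k, rfl, hk⟩ := exists_of_coeff_expand_ne_zero hm
    rw [map_nsmul, smul_eq_mul]
    exact Nat.mul_le_mul_left _ (hN k hk)
  · conv_rhs => rw [← hinv g hg]
    exact (expand_rename n hn g f).symm

theorem mem_boundedInvariants_of_nsmul {f : MvPowerSeries σ ℤ} {n : ℕ} (hn : n ≠ 0)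
    (hf : n • f ∈ boundedInvariants w) : f ∈ boundedInvariants w := by
  obtain ⟨⟨N, hN⟩, hinv⟩ := hf
  refine ⟨⟨N, fun m hm => hN m ?_⟩, fun g hg => nsmul_right_injective hn ?_⟩
  · rw [map_nsmul]
    exact smul_ne_zero hn hm
  · simpa only [map_nsmul] using hinv g hg

theorem mem_homogeneousPart_of_nsmul {f : boundedInvariants w} {n d : ℕ} (hn : n ≠ 0)
    (hf : n • f ∈ homogeneousPart w d) : f ∈ homogeneousPart w d := by
  intro m hm
  refine hf m ?_
  have hcoe : ((n • f : boundedInvariants w) : MvPowerSeries σ ℤ) = n • (f : MvPowerSeries σ ℤ) :=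
    rfl
  rw [hcoe, map_nsmul]
  exact smul_ne_zero hn hm

theorem lam_mem_boundedInvariants (n : ℕ) (f : MvPowerSeries σ ℤ) (hf : f ∈ boundedInvariants w) :
    (powerSeriesLambda σ).lam n f ∈ boundedInvariants w := by
  have : SetLike.GradedMonoid fun _ : ℕ => (boundedInvariants w).toAddSubgroup :=
    { one_mem := one_mem (boundedInvariants w)
      mul_mem := fun _ _ _ _ => mul_mem (S := Subring (MvPowerSeries σ ℤ)) }
  refine LambdaStructure.lam_mem_of_adams_mem (fun _ => (boundedInvariants w).toAddSubgroup)
    (fun _ n hn r => mem_boundedInvariants_of_nsmul hn) (d := 0) (fun n hn => ?_) n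
  rw [adams_powerSeriesLambda hn]
  exact expand_mem_boundedInvariants hf n hn

variable (w)

/-- The `λ`-structure on invariant power series of bounded degree in which `λ_t` of a monomial `m`
is `1 + m t`. -/
noncomputable def invariantsLambda : LambdaStructure (boundedInvariants w) :=
  (powerSeriesLambda σ).restrict _ lam_mem_boundedInvariants

variable {w}

theorem coe_lam_invariantsLambda (n : ℕ) (f : boundedInvariants w) :
    ((invariantsLambda w).lam n f : MvPowerSeries σ ℤ) = (powerSeriesLambda σ).lam n f :=
  LambdaStructure.coe_lam_restrict _ n f

theorem coe_adams_invariantsLambda {n : ℕ} (hn : n ≠ 0) (f : boundedInvariants w) :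
    ((invariantsLambda w).adams n f : MvPowerSeries σ ℤ) = expand n hn f := by
  rw [invariantsLambda, LambdaStructure.coe_adams_restrict, adams_powerSeriesLambda hn]

theorem isSpecial_invariantsLambda : (invariantsLambda w).IsSpecial := by
  refine LambdaStructure.isSpecial_of_adams (fun n hn => Subtype.ext ?_)
    (fun n hn f g => Subtype.ext ?_) fun m n hm hn f => Subtype.ext ?_
  · rw [coe_adams_invariantsLambda hn, Subring.coe_one, map_one]
  · rw [coe_adams_invariantsLambda hn, Subring.coe_mul, map_mul, Subring.coe_mul,
      coe_adams_invariantsLambda hn, coe_adams_invariantsLambda hn]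
  · rw [coe_adams_invariantsLambda hm, coe_adams_invariantsLambda hn,
      coe_adams_invariantsLambda (Nat.mul_ne_zero hm hn), expand_mul]

theorem isGraded_invariantsLambda : (invariantsLambda w).IsGraded (homogeneousPart w) := by
  intro n d f hf
  refine LambdaStructure.lam_mem_of_adams_mem (homogeneousPart w)
    (fun d n hn r => mem_homogeneousPart_of_nsmul hn)
    (fun n hn m hm => ?_) n
  rw [coe_adams_invariantsLambda hn] at hm
  obtain ⟨k, rfl, hk⟩ := exists_of_coeff_expand_ne_zero hm
  rw [map_nsmul, smul_eq_mul, hf k hk]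

end BoundedInvariants

section ElementarySymmetric

open MvPowerSeries

variable {σ τ : Type*}

/-- The exponent of the squarefree monomial `∏_{s ∈ T} x_s`. -/
noncomputable def squarefreeExponent (T : Finset σ) : σ →₀ ℕ :=
  ∑ s ∈ T, Finsupp.single s 1

open Classical in
theorem squarefreeExponent_apply (T : Finset σ) (s : σ) :
    squarefreeExponent T s = if s ∈ T then 1 else 0 := by
  simp [squarefreeExponent, Finsupp.finsetSum_apply, Finsupp.single_apply]

theorem support_squarefreeExponent (T : Finset σ) : (squarefreeExponent T).support = T := by
  ext s
  simp [squarefreeExponent_apply]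

theorem squarefreeExponent_injective :
    Function.Injective (squarefreeExponent : Finset σ → σ →₀ ℕ) :=
  Function.LeftInverse.injective support_squarefreeExponent

theorem squarefreeExponent_singleton (s : σ) :
    squarefreeExponent {s} = Finsupp.single s 1 :=
  Finset.sum_singleton _ _

theorem mapDomain_squarefreeExponent (e : σ ↪ τ) (T : Finset σ) :
    Finsupp.mapDomain e (squarefreeExponent T) = squarefreeExponent (T.map e) := by
  rw [squarefreeExponent, squarefreeExponent, Finsupp.mapDomain_finsetSum, Finset.sum_map]
  exact Finset.sum_congr rfl fun s _ => Finsupp.mapDomain_single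

theorem weight_squarefreeExponent (w : σ → ℕ) (T : Finset σ) :
    Finsupp.weight w (squarefreeExponent T) = ∑ s ∈ T, w s := by
  rw [squarefreeExponent, map_sum]
  exact Finset.sum_congr rfl fun s _ => by rw [Finsupp.weight_single, one_smul]

open Classical in
/-- The elementary symmetric series of degree `n` in the variables indexed by `A`, the formal sum
of all products of `n` distinct such variables. -/
noncomputable def esymmSeries (A : Set σ) (n : ℕ) : MvPowerSeries σ ℤ := fun m =>
  if ∃ T : Finset σ, ↑T ⊆ A ∧ T.card = n ∧ squarefreeExponent T = m then 1 else 0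

open Classical in
theorem coeff_esymmSeries (A : Set σ) (n : ℕ) (m : σ →₀ ℕ) :
    coeff m (esymmSeries A n) =
      if ∃ T : Finset σ, ↑T ⊆ A ∧ T.card = n ∧ squarefreeExponent T = m then 1 else 0 :=
  rfl

open Classical in
theorem coeff_esymmSeries_one (A : Set σ) (m : σ →₀ ℕ) :
    coeff m (esymmSeries A 1) = if ∃ s ∈ A, Finsupp.single s 1 = m then 1 else 0 := by
  rw [coeff_esymmSeries]
  refine if_congr ⟨?_, ?_⟩ rfl rfl
  · rintro ⟨T, hT, hcard, rfl⟩
    obtain ⟨s, rfl⟩ := Finset.card_eq_one.1 hcard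
    exact ⟨s, hT (by simp), (squarefreeExponent_singleton s).symm⟩
  · rintro ⟨s, hs, rfl⟩
    exact ⟨{s}, by simpa using hs, Finset.card_singleton s, squarefreeExponent_singleton s⟩

theorem exists_of_coeff_esymmSeries_ne_zero {A : Set σ} {n : ℕ} {m : σ →₀ ℕ}
    (hm : coeff m (esymmSeries A n) ≠ 0) :
    ∃ T : Finset σ, ↑T ⊆ A ∧ T.card = n ∧ squarefreeExponent T = m := by
  classical
  rw [coeff_esymmSeries] at hm
  exact (ite_ne_right_iff.1 hm).1

theorem coeff_esymmSeries_squarefreeExponent {A : Set σ} {T : Finset σ} (hT : ↑T ⊆ A) :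
    coeff (squarefreeExponent T) (esymmSeries A T.card) = 1 := by
  classical
  rw [coeff_esymmSeries, if_pos ⟨T, hT, rfl, rfl⟩]

theorem rename_esymmSeries (e : σ ↪ τ) (A : Set σ) (n : ℕ) :
    rename e (esymmSeries A n) = esymmSeries (e '' A) n := by
  classical
  have hiff (m : τ →₀ ℕ) :
      (∃ T : Finset τ, ↑T ⊆ e '' A ∧ T.card = n ∧ squarefreeExponent T = m) ↔
        ∃ T : Finset σ, ↑T ⊆ A ∧ T.card = n ∧ Finsupp.embDomain e (squarefreeExponent T) = m := by
    simp only [Finset.subset_set_image_iff, Finsupp.embDomain_eq_mapDomain,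
      mapDomain_squarefreeExponent, Finset.map_eq_image]
    constructor
    · rintro ⟨_, ⟨T, hT, rfl⟩, hcard, rfl⟩
      exact ⟨T, hT, by rwa [Finset.card_image_of_injective _ e.injective] at hcard, rfl⟩
    · rintro ⟨T, hT, hcard, rfl⟩
      exact ⟨_, ⟨T, hT, rfl⟩, by rwa [Finset.card_image_of_injective _ e.injective], rfl⟩
  ext m
  by_cases hm : m ∈ Set.range (Finsupp.mapDomain (M := ℕ) e)
  · obtain ⟨k, rfl⟩ := hm
    rw [← Finsupp.embDomain_eq_mapDomain, coeff_embDomain_rename, coeff_esymmSeries,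
      coeff_esymmSeries, hiff]
    simp only [(Finsupp.embDomain_injective e).eq_iff]
  · rw [coeff_rename_eq_zero _ _ hm, coeff_esymmSeries, hiff, if_neg]
    rintro ⟨T, -, -, rfl⟩
    exact hm ⟨_, (Finsupp.embDomain_eq_mapDomain _ _).symm⟩

theorem IsLambdaSeries.linearProd {ι : Type*} [Fintype ι] (m : ι → σ →₀ ℕ) :
    IsLambdaSeries (∑ i, monomial (m i) (1 : ℤ)) (linearProd fun i => monomial (m i) (1 : ℤ)) where
  constantCoeff_eq_one := constantCoeff_linearProd _
  coeff_ghostSeries n hn := by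
    rw [coeff_ghostSeries_linearProd _ hn, map_sum]
    exact Finset.sum_congr rfl fun i _ => by rw [expand_monomial, monomial_pow, one_pow]

theorem coeff_linearProd_monomial_single (S : Finset σ) (n : ℕ) :
    PowerSeries.coeff n (linearProd fun s : S => monomial (Finsupp.single (s : σ) 1) (1 : ℤ)) =
      esymmSeries S n := by
  classical
  have hprod (T : Finset S) : ∏ s ∈ T, monomial (Finsupp.single (s : σ) 1) (1 : ℤ) =
      monomial (squarefreeExponent (T.map (.subtype _))) (1 : ℤ) := by
    rw [prod_monomial, Finset.prod_const_one, squarefreeExponent, Finset.sum_map]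
    rfl
  ext μ
  simp only [coeff_linearProd, hprod, map_sum, coeff_monomial, coeff_esymmSeries]
  split_ifs with h
  · obtain ⟨T, hT, hcard, rfl⟩ := h
    obtain ⟨T, rfl⟩ : ∃ T' : Finset S, T'.map (.subtype _) = T :=
      ⟨_, Finset.subtype_map_of_mem hT⟩
    rw [Finset.card_map] at hcard
    rw [Finset.sum_eq_single_of_mem T
      (Finset.mem_powersetCard.2 ⟨Finset.subset_univ T, hcard⟩), if_pos rfl]
    exact fun T' _ hne => if_neg fun h =>
      hne (Finset.map_injective _ (squarefreeExponent_injective h)).symm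
  · refine Finset.sum_eq_zero fun T hT => if_neg ?_
    rintro rfl
    refine h ⟨_, ?_, by rw [Finset.card_map, (Finset.mem_powersetCard.1 hT).2], rfl⟩
    exact_mod_cast Finset.map_subtype_subset T

theorem esymmSeries_sub_mem_cutoffIdeal {A B : Set σ} {μ : σ →₀ ℕ}
    (h : ∀ s ∈ μ.support, s ∈ A ↔ s ∈ B) (n : ℕ) :
    esymmSeries A n - esymmSeries B n ∈ cutoffIdeal ℤ μ := by
  classical
  intro κ hκ
  rw [map_sub, sub_eq_zero, coeff_esymmSeries, coeff_esymmSeries]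
  refine if_congr (exists_congr fun T => and_congr_left ?_) rfl rfl
  rintro ⟨-, rfl⟩
  refine forall₂_congr fun s hs => h s (Finsupp.support_mono hκ ?_)
  rwa [support_squarefreeExponent]

theorem lam_esymmSeries_one (A : Set σ) (n : ℕ) :
    (powerSeriesLambda σ).lam n (esymmSeries A 1) = esymmSeries A n := by
  classical
  refine eq_of_forall_mk_cutoffIdeal_eq fun μ => ?_
  let S := μ.support.filter (· ∈ A)
  have hS : ∀ s ∈ μ.support, s ∈ A ↔ s ∈ (S : Set σ) := fun s hs => by simp [S] at hs ⊢; tauto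
  have hS1 : IsLambdaSeries (esymmSeries (S : Set σ) 1)
      (linearProd fun s : S => monomial (Finsupp.single (s : σ) 1) (1 : ℤ)) := by
    have h := IsLambdaSeries.linearProd fun s : S => Finsupp.single (s : σ) 1
    rwa [← h.coeff_one, coeff_linearProd_monomial_single] at h
  have hmap := congrArg (PowerSeries.coeff n) <|
    (isLambdaSeries_series (esymmSeries A 1)).map_mk_eq hS1 (esymmSeries_sub_mem_cutoffIdeal hS 1)
  rw [PowerSeries.coeff_map, PowerSeries.coeff_map, coeff_linearProd_monomial_single] at hmap
  exact hmap.trans (Ideal.Quotient.eq.2 (esymmSeries_sub_mem_cutoffIdeal hS n)).symm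

end ElementarySymmetric

section LeadingExponent

open MvPowerSeries

variable {σ ι R : Type*} [CommRing R] {c : (σ →₀ ℕ) →+ ℕ} {f g : MvPowerSeries σ R}
  {m k : σ →₀ ℕ}

/-- `m` is the leading exponent of `f` for the cost `c`: its coefficient is one and all other
exponents of `f` have larger cost. -/
structure HasLeadingExponent (c : (σ →₀ ℕ) →+ ℕ) (f : MvPowerSeries σ R) (m : σ →₀ ℕ) :
    Prop where
  coeff_eq_one : coeff m f = 1
  eq_or_lt : ∀ m', coeff m' f ≠ 0 → m' = m ∨ c m < c m'

namespace HasLeadingExponent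

protected theorem one : HasLeadingExponent c (1 : MvPowerSeries σ R) 0 where
  coeff_eq_one := coeff_zero_one
  eq_or_lt m' h := by
    classical
    rw [coeff_one] at h
    exact Or.inl (ite_ne_right_iff.1 h).1

protected theorem mul (hf : HasLeadingExponent c f m) (hg : HasLeadingExponent c g k) :
    HasLeadingExponent c (f * g) (m + k) := by
  classical
  have hcost {p q : σ →₀ ℕ} (h : coeff p f * coeff q g ≠ 0) :
      (p, q) = (m, k) ∨ c (m + k) < c (p + q) := by
    have hp := hf.eq_or_lt p (left_ne_zero_of_mul h)
    have hq := hg.eq_or_lt q (right_ne_zero_of_mul h)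
    rw [map_add, map_add, Prod.mk.injEq]
    rcases hp with rfl | hp <;> rcases hq with rfl | hq <;> first | simp; done | omega
  constructor
  · rw [coeff_mul, Finset.sum_eq_single_of_mem (m, k)
      (Finset.HasAntidiagonal.mem_antidiagonal.2 rfl), hf.coeff_eq_one, hg.coeff_eq_one, one_mul]
    rintro ⟨p, q⟩ hpq hne
    by_contra h
    exact ((hcost h).resolve_left hne).ne'
      (congrArg c (Finset.HasAntidiagonal.mem_antidiagonal.1 hpq))
  · intro m' h
    rw [coeff_mul] at h
    obtain ⟨⟨p, q⟩, hpq, hne⟩ := Finset.exists_ne_zero_of_sum_ne_zero h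
    rw [← Finset.HasAntidiagonal.mem_antidiagonal.1 hpq]
    exact (hcost hne).imp_left fun h => by rw [(Prod.ext_iff.1 h).1, (Prod.ext_iff.1 h).2]

protected theorem pow (hf : HasLeadingExponent c f m) (n : ℕ) :
    HasLeadingExponent c (f ^ n) (n • m) := by
  induction n with
  | zero => rw [pow_zero, zero_smul]; exact .one
  | succ n ih => rw [pow_succ, succ_nsmul]; exact ih.mul hf

protected theorem prod (s : Finset ι) {f : ι → MvPowerSeries σ R} {m : ι → σ →₀ ℕ}
    (h : ∀ i, HasLeadingExponent c (f i) (m i)) :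
    HasLeadingExponent c (∏ i ∈ s, f i) (∑ i ∈ s, m i) := by
  induction s using Finset.cons_induction with
  | empty => exact .one
  | cons a s ha ih => rw [Finset.prod_cons, Finset.sum_cons]; exact (h a).mul ih

variable {b : ι → MvPowerSeries σ R} {ℓ : ι → σ →₀ ℕ}

theorem linearIndependent (hb : ∀ i, HasLeadingExponent c (b i) (ℓ i))
    (hℓ : Function.Injective ℓ) : LinearIndependent R b := by
  rw [linearIndependent_iff]
  intro a ha
  by_contra hne
  obtain ⟨i, hi, hmin⟩ := Finset.exists_min_image a.support (fun i => c (ℓ i))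
    (Finsupp.support_nonempty_iff.2 hne)
  have hcoeff := congrArg (coeff (ℓ i)) ha
  rw [Finsupp.linearCombination_apply, Finsupp.sum, map_sum, map_zero,
    Finset.sum_eq_single_of_mem i hi, coeff_smul, (hb i).coeff_eq_one, mul_one] at hcoeff
  · exact Finsupp.mem_support_iff.1 hi hcoeff
  · intro j hj hji
    by_contra h
    rw [coeff_smul] at h
    rcases (hb j).eq_or_lt _ (right_ne_zero_of_mul h) with h | h
    · exact hji (hℓ h).symm
    · exact (hmin j hj).not_gt h

theorem exists_mem_span_forall_lt (hb : ∀ i, HasLeadingExponent c (b i) (ℓ i)) {n : ℕ}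
    (hn : ∀ m, coeff m f ≠ 0 → n ≤ c m) (hfin : {m | coeff m f ≠ 0 ∧ c m = n}.Finite)
    (hℓ : {m | coeff m f ≠ 0 ∧ c m = n} ⊆ Set.range ℓ) :
    ∃ g ∈ Submodule.span R (Set.range b), ∀ m, coeff m (f - g) ≠ 0 → n < c m := by
  classical
  rcases isEmpty_or_nonempty ι with hι | hι
  · rw [Set.range_eq_empty, Set.subset_empty_iff, Set.eq_empty_iff_forall_notMem] at hℓ
    refine ⟨0, zero_mem _, fun m hm => ?_⟩
    rw [sub_zero] at hm
    exact (hn m hm).lt_of_ne fun h => hℓ m ⟨hm, h.symm⟩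
  have hex : ∀ m, coeff m f ≠ 0 ∧ c m = n → ∃ i, ℓ i = m := fun m hm => hℓ hm
  choose! i hi using hex
  have hcoeff (m k : σ →₀ ℕ) (hm : m ∈ hfin.toFinset) (hk : c k ≤ n) :
      coeff k (b (i m)) = if k = m then 1 else 0 := by
    rw [hfin.mem_toFinset] at hm
    have hlead := hi m hm ▸ hb (i m)
    split_ifs with h
    · rw [h, hlead.coeff_eq_one]
    · by_contra h'
      exact ((hlead.eq_or_lt k h').resolve_left h).not_ge (hk.trans hm.2.ge)
  refine ⟨∑ m ∈ hfin.toFinset, coeff m f • b (i m), sum_mem fun m _ =>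
    Submodule.smul_mem _ _ (Submodule.subset_span ⟨_, rfl⟩), fun k hk => ?_⟩
  by_contra! hkn
  refine hk ?_
  rw [map_sub, map_sum, sub_eq_zero]
  simp only [coeff_smul]
  rw [Finset.sum_congr rfl fun m hm => by rw [hcoeff m k hm hkn, mul_ite, mul_one, mul_zero],
    Finset.sum_ite_eq, eq_comm, ite_eq_left_iff, hfin.mem_toFinset]
  intro h
  by_contra h'
  exact h ⟨Ne.symm h', le_antisymm hkn (hn k (Ne.symm h'))⟩

-- Subtracting combinations of the `b i` raises the minimal cost of `f` until it exceeds `N`.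
theorem le_span (hb : ∀ i, HasLeadingExponent c (b i) (ℓ i))
    {V : Submodule R (MvPowerSeries σ R)} (hbV : ∀ i, b i ∈ V)
    (hfin : ∀ f ∈ V, ∀ n, {m | coeff m f ≠ 0 ∧ c m = n}.Finite) {N : ℕ}
    (hmin : ∀ f ∈ V, ∀ m, coeff m f ≠ 0 → (∀ k, coeff k f ≠ 0 → c m ≤ c k) →
      m ∈ Set.range ℓ ∧ c m ≤ N) :
    V ≤ Submodule.span R (Set.range b) := by
  have hspan : Submodule.span R (Set.range b) ≤ V :=
    Submodule.span_le.2 (Set.range_subset_iff.2 hbV)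
  suffices key : ∀ n ≤ N + 1, ∀ f ∈ V, (∀ m, coeff m f ≠ 0 → n ≤ c m) →
      f ∈ Submodule.span R (Set.range b) from
    fun f hf => key 0 (Nat.zero_le _) f hf fun _ _ => Nat.zero_le _
  intro n hn
  induction hn using Nat.decreasingInduction with
  | self =>
    intro f hf hfN
    rcases eq_or_ne f 0 with rfl | hne
    · exact zero_mem _
    obtain ⟨k, hk⟩ := (ne_zero_iff_exists_coeff_ne_zero f).1 hne
    have hex : {m | coeff m f ≠ 0}.Nonempty := ⟨k, hk⟩
    have hm := (hmin f hf _ (Function.argminOn_mem c _ hex)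
      fun k hk => Function.argminOn_le c _ hk).2
    exact absurd (hfN _ (Function.argminOn_mem c _ hex)) (by omega)
  | of_succ n _ ih =>
    intro f hf hfn
    obtain ⟨g, hg, hfg⟩ := exists_mem_span_forall_lt hb hfn (hfin f hf n) fun m hm =>
      (hmin f hf m hm.1 fun k hk => hm.2.trans_le (hfn k hk)).1
    rw [← sub_add_cancel f g]
    exact add_mem (ih _ (sub_mem hf (hspan hg)) hfg) hg

end HasLeadingExponent

end LeadingExponent

section Swap

open Finsupp

variable {σ : Type*} [DecidableEq σ] {v : σ → ℕ} {p q : σ} {m : σ →₀ ℕ}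

theorem weight_mapDomain_swap (v : σ → ℕ) (p q : σ) (m : σ →₀ ℕ) :
    weight v (mapDomain (Equiv.swap p q) m) + m p * v p + m q * v q =
      weight v m + m p * v q + m q * v p := by
  induction m using Finsupp.induction_linear with
  | zero => simp
  | add m k hm hk =>
    simp only [mapDomain_add, map_add, Finsupp.add_apply]
    linear_combination hm + hk
  | single r n =>
    rw [mapDomain_single, weight_single, weight_single, smul_eq_mul, smul_eq_mul]
    rcases eq_or_ne r p with rfl | hp
    · rcases eq_or_ne r q with rfl | hq
      · simp
      · rw [Equiv.swap_apply_left, single_eq_same, single_eq_of_ne hq.symm]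
        ring
    · rcases eq_or_ne r q with rfl | hq
      · rw [Equiv.swap_apply_right, single_eq_same, single_eq_of_ne hp.symm]
        ring
      · rw [Equiv.swap_apply_of_ne_of_ne hp hq, single_eq_of_ne hp.symm, single_eq_of_ne hq.symm]
        ring

theorem weight_mapDomain_swap_lt (hv : v p < v q) (hm : m p < m q) :
    weight v (mapDomain (Equiv.swap p q) m) < weight v m := by
  nlinarith [weight_mapDomain_swap v p q m]

theorem apply_le_apply_of_forall_weight_le {f : MvPowerSeries σ ℤ}
    (hf : MvPowerSeries.renameEquiv ℤ (Equiv.swap p q) f = f)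
    (hm : MvPowerSeries.coeff m f ≠ 0)
    (hmin : ∀ k, MvPowerSeries.coeff k f ≠ 0 → weight v m ≤ weight v k) (hv : v p < v q) :
    m q ≤ m p := by
  by_contra! hlt
  refine (weight_mapDomain_swap_lt hv hlt).not_ge (hmin _ ?_)
  rwa [(renameEquiv_eq_iff _ f).1 hf]

end Swap

namespace SymFun

open MvPowerSeries

/-- The elementary symmetric function `e_n`. -/
noncomputable def elem (n : ℕ) : SymFun where
  val := esymmSeries Set.univ n
  property := by
    refine ⟨⟨n, fun m hm => ?_⟩, fun g _ => ?_⟩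
    · obtain ⟨T, -, rfl, rfl⟩ := exists_of_coeff_esymmSeries_ne_zero hm
      simp [weight_squarefreeExponent]
    · exact (rename_esymmSeries g.toEmbedding Set.univ n).trans
        (congrArg (esymmSeries · n) (Set.image_univ_of_surjective g.surjective))

theorem elem_mem_grading (n : ℕ) : elem n ∈ grading n := by
  intro m hm
  obtain ⟨T, -, rfl, rfl⟩ := exists_of_coeff_esymmSeries_ne_zero hm
  simp [weight_squarefreeExponent]

theorem elem_mem_scaledGrading (n : ℕ+) (k : ℕ) :
    elem k ∈ scaledGrading grading n (n * k) := by
  rw [scaledGrading, if_pos (dvd_mul_right _ _), Nat.mul_div_cancel_left _ n.pos]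
  exact elem_mem_grading k

theorem lam_elem_one (n : ℕ) : (invariantsLambda _).lam n (elem 1) = elem n :=
  Subtype.ext ((coe_lam_invariantsLambda n _).trans (lam_esymmSeries_one _ n))

theorem isGraded_scaledGrading (n : ℕ+) :
    (invariantsLambda _).IsGraded (scaledGrading grading n) := by
  intro k d f hf
  unfold scaledGrading at hf
  split_ifs at hf with h
  · rw [scaledGrading, if_pos (h.mul_left k), Nat.mul_div_assoc _ h]
    exact isGraded_invariantsLambda k _ f hf
  · obtain rfl := AddSubgroup.mem_bot.1 hf
    rcases eq_or_ne k 0 with rfl | hk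
    · rw [LambdaStructure.lam_zero, zero_mul, scaledGrading, if_pos (dvd_zero _), Nat.zero_div]
      exact SetLike.one_mem_graded _
    · rw [LambdaStructure.lam, LambdaStructure.series_zero, PowerSeries.coeff_one, if_neg hk]
      exact zero_mem _

end SymFun

namespace PolySymFun

open MvPowerSeries

theorem coe_incl (n : ℕ+) (f : SymFun) :
    (incl n f : MvPowerSeries (ℕ+ × ℕ+) ℤ) = rename (block n) (f : MvPowerSeries ℕ+ ℤ) :=
  rfl

theorem incl_lam (n : ℕ+) (k : ℕ) (f : SymFun) :
    incl n ((invariantsLambda _).lam k f) = (invariantsLambda _).lam k (incl n f) := by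
  refine LambdaStructure.map_lam_of_adams (incl n).toRingHom (fun i hi => Subtype.ext ?_) k
  change (incl n ((invariantsLambda _).adams i f) : MvPowerSeries (ℕ+ × ℕ+) ℤ) =
    (invariantsLambda _).adams i (incl n f)
  rw [coe_adams_invariantsLambda hi, coe_incl, coe_incl, coe_adams_invariantsLambda hi,
    expand_rename]

theorem incl_elem_one (n : ℕ+) : incl n (SymFun.elem 1) = M n := by
  classical
  refine Subtype.ext
    ((rename_esymmSeries (block n) Set.univ 1).trans (MvPowerSeries.ext fun m => ?_))
  rw [coeff_esymmSeries_one]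
  change _ = coeff m (sumVars n)
  rw [coeff_sumVars]
  refine if_congr ?_ rfl rfl
  rw [Set.image_univ, Set.exists_range_iff]
  exact exists_congr fun j => eq_comm

/-- The elementary symmetric function of degree `p.2` in the variables `x_{ij}` with `i = p.1`. -/
noncomputable def elem (p : ℕ+ × ℕ+) : PolySymFun :=
  incl p.1 (SymFun.elem p.2)

theorem lam_M (p : ℕ+ × ℕ+) : (invariantsLambda _).lam p.2 (M p.1) = elem p := by
  rw [elem, ← SymFun.lam_elem_one, incl_lam, incl_elem_one]

theorem elem_mem_grading (p : ℕ+ × ℕ+) : elem p ∈ grading (p.1 * p.2) :=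
  (incl p.1).map_mem (SymFun.elem_mem_scaledGrading p.1 p.2)

end PolySymFun

theorem finite_setOf_weight_eq {σ : Type*} {w : σ → ℕ} (hw : ∀ s, w s ≠ 0)
    (hfin : ∀ n, {s | w s ≤ n}.Finite) (n : ℕ) :
    {m : σ →₀ ℕ | Finsupp.weight w m = n}.Finite := by
  classical
  refine (Set.finite_Iic (∑ s ∈ (hfin n).toFinset, Finsupp.single s n)).subset ?_
  rintro m rfl s
  rcases eq_or_ne (m s) 0 with h | h
  · rw [h]
    exact Nat.zero_le _
  · rw [Finsupp.finsetSum_apply, Finset.sum_eq_single_of_mem s, Finsupp.single_eq_same]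
    · exact Finsupp.le_weight w (hw s) m
    · rw [Set.Finite.mem_toFinset]
      exact Finsupp.le_weight_of_ne_zero' w h
    · exact fun t _ hts => Finsupp.single_eq_of_ne hts.symm

theorem sum_Icc_one_lt_sum {T : Finset ℕ+} {n : ℕ+} (hT : T.card = n)
    (hne : T ≠ Finset.Icc 1 n) :
    ∑ j ∈ Finset.Icc 1 n, (j : ℕ) < ∑ j ∈ T, (j : ℕ) := by
  set I := Finset.Icc 1 n
  have hI : I.card = n := by simp [I, PNat.card_Icc]
  have hcard : (I \ T).card = (T \ I).card := Finset.card_sdiff_comm (hI.trans hT.symm)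
  have hpos : 0 < (T \ I).card :=
    Finset.card_pos.2 <| Finset.sdiff_nonempty.2 fun h =>
      hne (Finset.eq_of_subset_of_card_le h (hI.trans hT.symm).le)
  have hsmall : ∑ j ∈ I \ T, (j : ℕ) ≤ (I \ T).card • (n : ℕ) :=
    Finset.sum_le_card_nsmul _ _ _ fun j hj => (Finset.mem_Icc.1 (Finset.mem_sdiff.1 hj).1).2
  have hlarge : (T \ I).card • (n + 1 : ℕ) ≤ ∑ j ∈ T \ I, (j : ℕ) := by
    refine Finset.card_nsmul_le_sum _ _ _ fun j hj => ?_
    have hj' := (Finset.mem_sdiff.1 hj).2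
    simp only [I, Finset.mem_Icc, one_le, true_and, not_le] at hj'
    exact hj'
  rw [← Finset.sum_inter_add_sum_sdiff I T, ← Finset.sum_inter_add_sum_sdiff T I,
    Finset.inter_comm T I]
  rw [hcard] at hsmall
  simp only [smul_eq_mul, mul_add, mul_one] at hsmall hlarge
  omega

namespace PolySymFun

open MvPowerSeries

/-- The degree of a monomial of `PS_ℤ`. -/
noncomputable abbrev deg : (ℕ+ × ℕ+ →₀ ℕ) →+ ℕ := Finsupp.weight fun p => (p.1 : ℕ)

/-- The sum of the second indices of the variables of a monomial of `PS_ℤ`, with multiplicity.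
Leading exponents in `PS_ℤ` are taken with respect to it. -/
noncomputable abbrev cost : (ℕ+ × ℕ+ →₀ ℕ) →+ ℕ := Finsupp.weight fun p => (p.2 : ℕ)

/-- The degree of the product of the powers `λ_j(M_i) ^ a (i, j)`. -/
noncomputable abbrev elemDeg : (ℕ+ × ℕ+ →₀ ℕ) →+ ℕ := Finsupp.weight fun p => (p.1 : ℕ) * p.2

theorem finite_setOf_deg_cost (d c : ℕ) : {m | deg m = d ∧ cost m = c}.Finite := by
  have hfin (n : ℕ) : {p : ℕ+ × ℕ+ | (p.1 : ℕ) + p.2 ≤ n}.Finite := by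
    refine (Set.finite_Iic (n.succPNat, n.succPNat)).subset fun p hp => ?_
    rw [Set.mem_ofPred_eq] at hp
    constructor <;> rw [← PNat.coe_le_coe, Nat.succPNat_coe] <;> omega
  refine (finite_setOf_weight_eq (fun p => by positivity) hfin (d + c)).subset ?_
  rintro m ⟨rfl, rfl⟩
  simp [Finsupp.weight_apply, Finsupp.sum_add, mul_add]

/-- The exponent of `x_{i1} x_{i2} ⋯ x_{ij}`, the leading monomial of `λ_j(M_i)`, for
`p = (i, j)`. -/
noncomputable def initialExponent (p : ℕ+ × ℕ+) : ℕ+ × ℕ+ →₀ ℕ :=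
  squarefreeExponent ((Finset.Icc 1 p.2).map (block p.1))

theorem initialExponent_apply (p q : ℕ+ × ℕ+) :
    initialExponent p q = if q.1 = p.1 ∧ q.2 ≤ p.2 then 1 else 0 := by
  have hmem : q ∈ (Finset.Icc 1 p.2).map (block p.1) ↔ q.1 = p.1 ∧ q.2 ≤ p.2 := by
    refine Finset.mem_map.trans ⟨?_, fun ⟨h1, h2⟩ => ?_⟩
    · rintro ⟨j, hj, rfl⟩
      exact ⟨rfl, (Finset.mem_Icc.1 hj).2⟩
    · exact ⟨q.2, Finset.mem_Icc.2 ⟨one_le, h2⟩, Prod.ext h1.symm rfl⟩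
  simp only [initialExponent, squarefreeExponent_apply, hmem]

theorem weight_squarefreeExponent_map_block (w : ℕ+ × ℕ+ → ℕ) (i : ℕ+) (T : Finset ℕ+) :
    Finsupp.weight w (squarefreeExponent (T.map (block i))) = ∑ j ∈ T, w (i, j) := by
  rw [weight_squarefreeExponent, Finset.sum_map]
  rfl

theorem deg_initialExponent (p : ℕ+ × ℕ+) : deg (initialExponent p) = p.1 * p.2 := by
  rw [initialExponent, weight_squarefreeExponent_map_block]
  simp [PNat.card_Icc, mul_comm]

theorem cost_initialExponent_le (p : ℕ+ × ℕ+) :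
    cost (initialExponent p) ≤ deg (initialExponent p) ^ 2 := by
  have hle : cost (initialExponent p) ≤ p.2 * p.2 := by
    rw [initialExponent, weight_squarefreeExponent_map_block]
    refine (Finset.sum_le_card_nsmul _ (fun j : ℕ+ => (j : ℕ)) p.2
      fun j hj => (Finset.mem_Icc.1 hj).2).trans ?_
    simp [PNat.card_Icc]
  have hi : (p.2 : ℕ) ≤ p.1 * p.2 := Nat.le_mul_of_pos_left _ p.1.pos
  rw [deg_initialExponent, sq]
  exact hle.trans (Nat.mul_le_mul hi hi)

theorem hasLeadingExponent_elem (p : ℕ+ × ℕ+) :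
    HasLeadingExponent cost (elem p : MvPowerSeries (ℕ+ × ℕ+) ℤ) (initialExponent p) where
  coeff_eq_one := by
    have hcard : (Finset.Icc 1 p.2).card = p.2 := by simp [PNat.card_Icc]
    have hcoeff := coeff_esymmSeries_squarefreeExponent
      (Set.subset_univ (Finset.Icc 1 p.2 : Set ℕ+))
    rw [elem, coe_incl, initialExponent, ← mapDomain_squarefreeExponent,
      ← Finsupp.embDomain_eq_mapDomain, coeff_embDomain_rename]
    rwa [hcard] at hcoeff
  eq_or_lt m hm := by
    obtain ⟨k, rfl, hk⟩ := exists_of_coeff_rename_block hm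
    obtain ⟨T, -, hT, rfl⟩ := exists_of_coeff_esymmSeries_ne_zero hk
    rw [Finsupp.embDomain_eq_mapDomain, mapDomain_squarefreeExponent, initialExponent]
    refine (eq_or_ne T (Finset.Icc 1 p.2)).imp (fun h => by rw [h]) fun h => ?_
    rw [weight_squarefreeExponent_map_block, weight_squarefreeExponent_map_block]
    exact sum_Icc_one_lt_sum hT h

/-- The exponent of the leading monomial of the product of the powers `λ_j(M_i) ^ a (i, j)`. -/
noncomputable def leadExponent : (ℕ+ × ℕ+ →₀ ℕ) →ₗ[ℕ] (ℕ+ × ℕ+ →₀ ℕ) :=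
  Finsupp.linearCombination ℕ initialExponent

theorem deg_leadExponent (a : ℕ+ × ℕ+ →₀ ℕ) : deg (leadExponent a) = elemDeg a := by
  induction a using Finsupp.induction_linear with
  | zero => simp only [map_zero]
  | add a b ha hb => simp only [map_add, ha, hb]
  | single p n =>
    rw [leadExponent, Finsupp.linearCombination_single, map_nsmul, deg_initialExponent,
      Finsupp.weight_single]

theorem cost_leadExponent_le (a : ℕ+ × ℕ+ →₀ ℕ) :
    cost (leadExponent a) ≤ deg (leadExponent a) ^ 2 := by
  induction a using Finsupp.induction_linear with
  | zero => simp only [map_zero, Nat.zero_le]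
  | add a b ha hb =>
    simp only [map_add, add_sq]
    omega
  | single p n =>
    rw [leadExponent, Finsupp.linearCombination_single, map_nsmul, map_nsmul, smul_eq_mul,
      smul_eq_mul, mul_pow]
    exact Nat.mul_le_mul (Nat.le_self_pow two_ne_zero n) (cost_initialExponent_le p)

theorem leadExponent_apply (a : ℕ+ × ℕ+ →₀ ℕ) (i j : ℕ+) :
    leadExponent a (i, j) = leadExponent a (i, j + 1) + a (i, j) := by
  classical
  induction a using Finsupp.induction_linear with
  | zero => simp
  | add a b ha hb => simp only [map_add, Finsupp.add_apply, ha, hb]; ring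
  | single p n =>
    simp only [leadExponent, Finsupp.linearCombination_single, Finsupp.smul_apply,
      initialExponent_apply, Finsupp.single_apply, Prod.ext_iff, PNat.add_one_le_iff,
      le_iff_lt_or_eq (a := j)]
    by_cases h1 : i = p.1 <;> by_cases h2 : j < p.2 <;> by_cases h3 : j = p.2 <;>
      simp_all [eq_comm]

theorem leadExponent_injective : Function.Injective leadExponent := by
  intro a b h
  ext ⟨i, j⟩
  have hij := leadExponent_apply a i j
  rw [h, leadExponent_apply b] at hij
  omega

theorem eq_of_forall_apply_eq_apply_add_one_add {f g a : ℕ+ × ℕ+ →₀ ℕ}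
    (hf : ∀ i j, f (i, j) = f (i, j + 1) + a (i, j))
    (hg : ∀ i j, g (i, j) = g (i, j + 1) + a (i, j)) : f = g := by
  classical
  ext ⟨i, j⟩
  have hconst (j : ℕ+) : f (i, j) + g (i, 1) = g (i, j) + f (i, 1) := by
    induction j using PNat.recOn with
    | one => exact add_comm _ _
    | succ j ih => have := hf i j; have := hg i j; omega
  obtain ⟨k, hk⟩ := Infinite.exists_notMem_finset ((f.support ∪ g.support).image Prod.snd)
  have hk' : (i, k) ∉ f.support ∪ g.support := fun h => hk (Finset.mem_image_of_mem Prod.snd h)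
  simp only [Finset.mem_union, Finsupp.mem_support_iff, not_or, not_not] at hk'
  have := hconst k
  have := hconst j
  omega

theorem exists_leadExponent_eq {m : ℕ+ × ℕ+ →₀ ℕ} (hm : ∀ i, Antitone fun j => m (i, j)) :
    ∃ a, leadExponent a = m := by
  let a : ℕ+ × ℕ+ →₀ ℕ := Finsupp.onFinset m.support (fun p => m p - m (p.1, p.2 + 1))
    fun p hp => Finsupp.mem_support_iff.2 (by omega)
  refine ⟨a, eq_of_forall_apply_eq_apply_add_one_add (leadExponent_apply a) fun i j => ?_⟩
  exact (Nat.add_sub_of_le (hm i (PNat.lt_add_right j 1).le)).symm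

theorem antitone_of_forall_cost_le {f : PolySymFun} {m : ℕ+ × ℕ+ →₀ ℕ}
    (hm : coeff m (f : MvPowerSeries (ℕ+ × ℕ+) ℤ) ≠ 0)
    (hmin : ∀ k, coeff k (f : MvPowerSeries (ℕ+ × ℕ+) ℤ) ≠ 0 → cost m ≤ cost k) (i : ℕ+) :
    Antitone fun j => m (i, j) := by
  intro j k hjk
  rcases hjk.eq_or_lt with rfl | hlt
  · exact le_rfl
  refine apply_le_apply_of_forall_weight_le (f.2.2 _ fun p => ?_) hm hmin hlt
  rw [Equiv.swap_apply_def]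
  split_ifs with h1 h2 <;> simp [*]

/-- The product of the powers `λ_j(M_i) ^ a (i, j)`. -/
noncomputable def elemMonomial (a : ℕ+ × ℕ+ →₀ ℕ) : PolySymFun :=
  a.prod fun p n => elem p ^ n

theorem hasLeadingExponent_elemMonomial (a : ℕ+ × ℕ+ →₀ ℕ) :
    HasLeadingExponent cost (elemMonomial a : MvPowerSeries (ℕ+ × ℕ+) ℤ) (leadExponent a) := by
  have hcoe : (elemMonomial a : MvPowerSeries (ℕ+ × ℕ+) ℤ) =
      ∏ p ∈ a.support, (elem p : MvPowerSeries (ℕ+ × ℕ+) ℤ) ^ a p := by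
    rw [elemMonomial, Finsupp.prod]
    push_cast
    rfl
  rw [hcoe]
  exact HasLeadingExponent.prod _ fun p => (hasLeadingExponent_elem p).pow (a p)

theorem prod_pow_mem_of_mem {R : Type*} [CommRing R] {𝒜 : ℕ → AddSubgroup R}
    [SetLike.GradedMonoid 𝒜] {e : ℕ+ × ℕ+ → R} (he : ∀ p, e p ∈ 𝒜 (p.1 * p.2))
    (a : ℕ+ × ℕ+ →₀ ℕ) : (a.prod fun p n => e p ^ n) ∈ 𝒜 (elemDeg a) := by
  rw [elemDeg, Finsupp.weight_apply, Finsupp.prod, Finsupp.sum]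
  exact SetLike.prod_mem_graded _ _ _ fun p _ => SetLike.pow_mem_graded _ (he p)

theorem mem_span_elemMonomial_of_mem_grading {d : ℕ} {f : PolySymFun} (hf : f ∈ grading d) :
    f ∈ Submodule.span ℤ (elemMonomial '' {a | elemDeg a = d}) := by
  let coe : PolySymFun →ₗ[ℤ] MvPowerSeries (ℕ+ × ℕ+) ℤ := PolySymFun.subtype.toIntLinearMap
  have hcoe : Function.Injective coe := Subtype.val_injective
  have hle : (AddSubgroup.toIntSubmodule (grading d)).map coe ≤ Submodule.span ℤ
      (Set.range fun a : {a // elemDeg a = d} =>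
        (elemMonomial a : MvPowerSeries (ℕ+ × ℕ+) ℤ)) := by
    refine HasLeadingExponent.le_span (ι := {a // elemDeg a = d}) (N := d ^ 2)
      (fun a => hasLeadingExponent_elemMonomial a.1) ?_ ?_ ?_
    · rintro ⟨a, rfl⟩
      exact ⟨_, prod_pow_mem_of_mem elem_mem_grading a, rfl⟩
    · rintro _ ⟨f, hf, rfl⟩ c
      exact (finite_setOf_deg_cost d c).subset fun m hm => ⟨hf m hm.1, hm.2⟩
    · rintro _ ⟨f, hf, rfl⟩ m hm hmin
      obtain ⟨a, rfl⟩ := exists_leadExponent_eq (antitone_of_forall_cost_le hm hmin)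
      have hd : deg (leadExponent a) = d := hf _ hm
      exact ⟨⟨⟨a, (deg_leadExponent a).symm.trans hd⟩, rfl⟩, hd ▸ cost_leadExponent_le a⟩
  have himage :
      (Set.range fun a : {a // elemDeg a = d} => (elemMonomial a : MvPowerSeries (ℕ+ × ℕ+) ℤ)) =
        coe '' (elemMonomial '' {a | elemDeg a = d}) := by
    rw [Set.image_image, Set.image_eq_range]
    rfl
  rw [himage, ← Submodule.map_span, Submodule.map_le_map_iff_of_injective hcoe] at hle
  exact hle hf

theorem closure_range_elem : Subring.closure (Set.range elem) = ⊤ := by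
  refine eq_top_iff.2 fun f _ => ?_
  induction f using DirectSum.Decomposition.inductionOn grading with
  | zero => exact zero_mem _
  | add f g hf hg => exact add_mem (hf trivial) (hg trivial)
  | homogeneous f =>
    suffices hle : Submodule.span ℤ (Set.range elemMonomial) ≤
        AddSubgroup.toIntSubmodule (Subring.closure (Set.range elem)).toAddSubgroup from
      hle (Submodule.span_mono (Set.image_subset_range _ _)
        (mem_span_elemMonomial_of_mem_grading f.2))
    rw [Submodule.span_le]
    rintro _ ⟨a, rfl⟩
    change elemMonomial a ∈ Subring.closure (Set.range elem)
    exact prod_mem fun p _ => pow_mem (Subring.subset_closure (Set.mem_range_self p)) _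

theorem ringHom_ext {S : Type*} [Semiring S] {φ ψ : PolySymFun →+* S}
    (h : ∀ p, φ (elem p) = ψ (elem p)) : φ = ψ :=
  RingHom.eq_of_eqOn_set_dense closure_range_elem (Set.forall_mem_range.2 h)

theorem aeval_elem_surjective :
    Function.Surjective (MvPolynomial.aeval (R := ℤ) elem) := by
  change Function.Surjective (MvPolynomial.aeval (R := ℤ) elem).toRingHom
  rw [← RingHom.range_eq_top, eq_top_iff, ← closure_range_elem, Subring.closure_le]
  rintro _ ⟨p, rfl⟩
  exact ⟨MvPolynomial.X p, MvPolynomial.aeval_X _ _⟩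

theorem linearIndependent_elemMonomial : LinearIndependent ℤ elemMonomial := by
  refine LinearIndependent.of_comp PolySymFun.subtype.toIntLinearMap ?_
  exact HasLeadingExponent.linearIndependent hasLeadingExponent_elemMonomial leadExponent_injective

theorem algebraicIndependent_elem : AlgebraicIndependent ℤ elem := by
  refine (injective_iff_map_eq_zero _).2 fun P hP => MvPolynomial.ext _ _ fun a => ?_
  rw [MvPolynomial.aeval_def, MvPolynomial.eval₂_eq] at hP
  simp only [← Algebra.smul_def] at hP
  by_contra ha
  exact ha (linearIndependent_iff'.1 linearIndependent_elemMonomial P.support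
    (fun b => P.coeff b) hP a (MvPolynomial.mem_support_iff.2 ha))

/-- The presentation of `PS_ℤ` as the polynomial ring on the `λ_j(M_i)`. -/
noncomputable def elemEquiv : MvPolynomial (ℕ+ × ℕ+) ℤ ≃ₐ[ℤ] PolySymFun :=
  AlgEquiv.ofBijective (MvPolynomial.aeval elem)
    ⟨algebraicIndependent_elem, aeval_elem_surjective⟩

theorem elemEquiv_symm_elem (p : ℕ+ × ℕ+) : elemEquiv.symm (elem p) = MvPolynomial.X p :=
  elemEquiv.symm_apply_eq.2 (MvPolynomial.aeval_X _ _).symm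

section Lift

variable {S : Type*} [CommRing S]

/-- The ring homomorphism out of `PS_ℤ` with prescribed values at the `λ_j(M_i)`. -/
noncomputable def liftRingHom (e : ℕ+ × ℕ+ → S) : PolySymFun →+* S :=
  (MvPolynomial.aeval (R := ℤ) e).toRingHom.comp elemEquiv.symm.toRingEquiv.toRingHom

theorem liftRingHom_elem (e : ℕ+ × ℕ+ → S) (p : ℕ+ × ℕ+) : liftRingHom e (elem p) = e p := by
  change MvPolynomial.aeval e (elemEquiv.symm (elem p)) = e p
  rw [elemEquiv_symm_elem, MvPolynomial.aeval_X]

theorem liftRingHom_elemMonomial (e : ℕ+ × ℕ+ → S) (a : ℕ+ × ℕ+ →₀ ℕ) :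
    liftRingHom e (elemMonomial a) = a.prod fun p n => e p ^ n := by
  simp only [elemMonomial, map_finsuppProd, map_pow, liftRingHom_elem]

variable (𝒮 : ℕ → AddSubgroup S) [SetLike.GradedMonoid 𝒮] (e : ℕ+ × ℕ+ → S)
  (he : ∀ p, e p ∈ 𝒮 (p.1 * p.2))

/-- The homomorphism `liftRingHom`, graded when the prescribed values have the degrees of the
`λ_j(M_i)`. -/
noncomputable def lift : GradedRingHom grading 𝒮 where
  toRingHom := liftRingHom e
  map_mem {d f} hf := by
    suffices hle : Submodule.span ℤ (elemMonomial '' {a | elemDeg a = d}) ≤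
        (AddSubgroup.toIntSubmodule (𝒮 d)).comap (liftRingHom e).toIntLinearMap from
      hle (mem_span_elemMonomial_of_mem_grading hf)
    rw [Submodule.span_le]
    rintro _ ⟨a, rfl, rfl⟩
    change liftRingHom e (elemMonomial a) ∈ 𝒮 (elemDeg a)
    rw [liftRingHom_elemMonomial]
    exact prod_pow_mem_of_mem he a

theorem lift_elem (p : ℕ+ × ℕ+) : (lift 𝒮 e he).toRingHom (elem p) = e p :=
  liftRingHom_elem e p

end Lift

theorem killCompl_block_incl (n : ℕ+) (f : SymFun) :
    killCompl (block n) (incl n f : MvPowerSeries (ℕ+ × ℕ+) ℤ) = (f : MvPowerSeries ℕ+ ℤ) := by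
  rw [coe_incl, killCompl_rename_app]

theorem eq_zero_of_embDomain_block_eq {n i : ℕ+} (hni : n ≠ i) {k l : ℕ+ →₀ ℕ}
    (h : Finsupp.embDomain (block n) k = Finsupp.embDomain (block i) l) : l = 0 := by
  ext j
  rw [← Finsupp.embDomain_apply_self (block i), ← h, Finsupp.embDomain_of_notMem_range]
  · rfl
  · rintro ⟨a, ha⟩
    exact hni (Prod.ext_iff.1 ha).1

theorem killCompl_block_elem_of_ne {n : ℕ+} {p : ℕ+ × ℕ+} (h : n ≠ p.1) :
    killCompl (block n) (elem p : MvPowerSeries (ℕ+ × ℕ+) ℤ) = 0 := by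
  ext k
  rw [coeff_killCompl, map_zero, elem, coe_incl]
  by_contra hk
  obtain ⟨l, hkl, hl⟩ := exists_of_coeff_rename_block hk
  obtain rfl := eq_zero_of_embDomain_block_eq h hkl
  have hdeg := SymFun.elem_mem_grading p.2 0 hl
  rw [map_zero] at hdeg
  exact p.2.ne_zero hdeg.symm

end PolySymFun

namespace SymFun

-- Setting the variables `x_{ij}` with `i ≠ 1` to `0` is a retraction of `PS_ℤ` onto `Λ`.
theorem closure_range_elem : Subring.closure (Set.range fun n : ℕ+ => elem n) = ⊤ := by
  refine eq_top_iff.2 fun f _ => ?_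
  let kill : PolySymFun →+* MvPowerSeries ℕ+ ℤ :=
    (MvPowerSeries.killCompl (PolySymFun.block 1)).toRingHom.comp PolySymFun.subtype
  let T : Subring (MvPowerSeries ℕ+ ℤ) :=
    (Subring.closure (Set.range fun n : ℕ+ => elem n)).map SymFun.subtype
  have hT : Subring.closure (Set.range PolySymFun.elem) ≤ T.comap kill := by
    rw [Subring.closure_le]
    rintro _ ⟨⟨i, j⟩, rfl⟩
    change MvPowerSeries.killCompl (PolySymFun.block 1)
      (PolySymFun.elem (i, j) : MvPowerSeries (ℕ+ × ℕ+) ℤ) ∈ T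
    rcases eq_or_ne 1 i with rfl | hi
    · rw [PolySymFun.elem, PolySymFun.killCompl_block_incl]
      exact ⟨_, Subring.subset_closure ⟨j, rfl⟩, rfl⟩
    · rw [PolySymFun.killCompl_block_elem_of_ne hi]
      exact zero_mem _
  have hf : PolySymFun.incl 1 f ∈ T.comap kill :=
    hT (PolySymFun.closure_range_elem ▸ Subring.mem_top _)
  obtain ⟨g, hg, hgf⟩ := hf
  obtain rfl : g = f := Subtype.ext (hgf.trans (PolySymFun.killCompl_block_incl 1 f))
  exact hg

theorem ringHom_ext {S : Type*} [Semiring S] {φ ψ : SymFun →+* S}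
    (h : ∀ n : ℕ+, φ (elem n) = ψ (elem n)) : φ = ψ :=
  RingHom.eq_of_eqOn_set_dense closure_range_elem (Set.forall_mem_range.2 h)

end SymFun

namespace LambdaStructure

open PowerSeries

variable {R S : Type*} [CommRing R] [CommRing S] {L : LambdaStructure R} {K : LambdaStructure S}
  {hL : L.IsSpecial} {hK : K.IsSpecial} {φ : R →+* S} {r : R}

/-- The subring of the elements whose series `λ_t` is preserved by the ring homomorphism `φ`. -/
def mapSeriesSubring (hL : L.IsSpecial) (hK : K.IsSpecial) (φ : R →+* S) : Subring R where
  carrier := {r | map φ (L.series r) = K.series (φ r)}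
  one_mem' := by
    simp only [Set.mem_ofPred_eq, hL.series_one, map_one, hK.series_one, map_add, map_X]
  zero_mem' := by
    simp only [Set.mem_ofPred_eq, series_zero, map_zero, map_one]
  add_mem' {r s} hr hs := by
    rw [Set.mem_ofPred_eq] at *
    rw [L.series_add, map_mul, map_add, K.series_add, hr, hs]
  mul_mem' {r s} hr hs := by
    rw [Set.mem_ofPred_eq] at *
    rw [hL.series_mul, map_wittMul, map_mul, hK.series_mul, hr, hs]
  neg_mem' {r} hr := by
    rw [Set.mem_ofPred_eq] at *
    have hmap : map φ (L.series (-r)) * map φ (L.series r) = 1 := by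
      rw [← map_mul, ← L.series_add, neg_add_cancel, L.series_zero, map_one]
    have hK' : K.series (φ r) * K.series (φ (-r)) = 1 := by
      rw [← K.series_add, map_neg, add_neg_cancel, K.series_zero]
    rw [hr] at hmap
    exact left_inv_eq_right_inv hmap hK'

theorem mem_mapSeriesSubring :
    r ∈ mapSeriesSubring hL hK φ ↔ map φ (L.series r) = K.series (φ r) :=
  Iff.rfl

theorem map_lam_of_mem_mapSeriesSubring (hr : r ∈ mapSeriesSubring hL hK φ) (k : ℕ) :
    φ (L.lam k r) = K.lam k (φ r) := by
  rw [lam, lam, ← mem_mapSeriesSubring.1 hr, coeff_map]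

theorem lam_mem_mapSeriesSubring (hr : r ∈ mapSeriesSubring hL hK φ) (k : ℕ) :
    L.lam k r ∈ mapSeriesSubring hL hK φ := by
  rw [mem_mapSeriesSubring, hL.series_lam, map_wittLam, map_lam_of_mem_mapSeriesSubring hr,
    hK.series_lam, mem_mapSeriesSubring.1 hr]

end LambdaStructure

theorem GradedLambdaHom.ext_toRingHom {R S : Type*} [CommRing R] [CommRing S]
    {𝒜 : ℕ → AddSubgroup R} {L : LambdaStructure R} {ℬ : ℕ → AddSubgroup S}
    {K : LambdaStructure S} {φ ψ : GradedLambdaHom 𝒜 L ℬ K} (h : φ.toRingHom = ψ.toRingHom) :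
    φ = ψ := by
  obtain ⟨⟨φ, _⟩, _⟩ := φ
  obtain ⟨⟨ψ, _⟩, _⟩ := ψ
  congr

namespace PolySymFun

variable {R : Type*} [CommRing R] {K : LambdaStructure R}

theorem map_lam_of_map_elem (hK : K.IsSpecial) (φ : PolySymFun →+* R)
    (h : ∀ p, φ (elem p) = K.lam p.2 (φ (M p.1))) (k : ℕ) (f : PolySymFun) :
    φ ((invariantsLambda _).lam k f) = K.lam k (φ f) := by
  let T := LambdaStructure.mapSeriesSubring isSpecial_invariantsLambda hK φ
  have hM (i : ℕ+) : M i ∈ T := by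
    refine PowerSeries.ext fun n => ?_
    rw [PowerSeries.coeff_map]
    rcases n.eq_zero_or_pos with rfl | hn
    · rw [LambdaStructure.coeff_zero, LambdaStructure.coeff_zero, map_one]
    · exact (congrArg φ (lam_M (i, ⟨n, hn⟩))).trans (h (i, ⟨n, hn⟩))
  have hT : Subring.closure (Set.range elem) ≤ T := by
    rw [Subring.closure_le]
    rintro _ ⟨p, rfl⟩
    rw [← lam_M]
    exact LambdaStructure.lam_mem_mapSeriesSubring (hM p.1) p.2
  exact LambdaStructure.map_lam_of_mem_mapSeriesSubring
    (hT (closure_range_elem ▸ Subring.mem_top f)) k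

variable (𝒜 : ℕ → AddSubgroup R) [SetLike.GradedMonoid 𝒜]

theorem existsUnique_gradedRingHom
    (f : ∀ n : ℕ+, GradedRingHom (scaledGrading SymFun.grading n) 𝒜) :
    ∃! F : GradedRingHom grading 𝒜, ∀ (n : ℕ+) (x : SymFun), F (incl n x) = f n x := by
  let F := lift 𝒜 (fun p => f p.1 (SymFun.elem p.2)) fun p =>
    (f p.1).map_mem (SymFun.elem_mem_scaledGrading p.1 p.2)
  have hF : ∀ p, F.toRingHom (elem p) = f p.1 (SymFun.elem p.2) := lift_elem _ _ _
  refine ⟨F, fun n x => ?_, fun G hG => ?_⟩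
  · have hcomp : F.toRingHom.comp (incl n).toRingHom = (f n).toRingHom :=
      SymFun.ringHom_ext fun j => hF (n, j)
    exact RingHom.congr_fun hcomp x
  · have hGF : G.toRingHom = F.toRingHom := ringHom_ext fun p => (hG _ _).trans (hF p).symm
    exact DFunLike.ext _ _ (RingHom.congr_fun hGF)

theorem existsUnique_gradedLambdaHom (hK : K.IsSpecial)
    (f : ∀ n : ℕ+, GradedLambdaHom (scaledGrading SymFun.grading n) (invariantsLambda _) 𝒜 K) :
    ∃! F : GradedLambdaHom grading (invariantsLambda _) 𝒜 K,
      ∀ (n : ℕ+) (x : SymFun), F.toRingHom (incl n x) = (f n).toRingHom x := by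
  obtain ⟨F, hF, hunique⟩ := existsUnique_gradedRingHom 𝒜 fun n => (f n).toGradedRingHom
  replace hF : ∀ n x, F.toRingHom (incl n x) = (f n).toRingHom x := hF
  have helem (p : ℕ+ × ℕ+) : F.toRingHom (elem p) = K.lam p.2 (F.toRingHom (M p.1)) := by
    rw [elem, ← incl_elem_one, hF, hF, ← SymFun.lam_elem_one, (f p.1).map_lam _ p.2.pos]
  refine ⟨⟨F, fun k _ => map_lam_of_map_elem hK F.toRingHom helem k⟩, hF, fun G hG => ?_⟩
  exact GradedLambdaHom.ext_toRingHom
    (congrArg GradedRingHom.toRingHom (hunique G.toGradedRingHom hG))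

theorem bijective_eval_M (hK : K.IsSpecial) (hgr : K.IsGraded 𝒜) :
    Function.Bijective fun (φ : GradedLambdaHom grading (invariantsLambda _) 𝒜 K) (d : ℕ+) =>
      (⟨φ.toRingHom (M d), φ.map_mem (M_mem d)⟩ : 𝒜 (d : ℕ)) := by
  constructor
  · intro φ ψ h
    have hM (d : ℕ+) : φ.toRingHom (M d) = ψ.toRingHom (M d) :=
      congrArg Subtype.val (congrFun h d)
    refine GradedLambdaHom.ext_toRingHom (ringHom_ext fun p => ?_)
    rw [← lam_M, φ.map_lam _ p.2.pos, ψ.map_lam _ p.2.pos, hM]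
  · intro r
    let F := lift 𝒜 (fun p => K.lam p.2 (r p.1)) fun p =>
      mul_comm (p.2 : ℕ) p.1 ▸ hgr _ _ _ (r p.1).2
    have hF : ∀ p, F.toRingHom (elem p) = K.lam p.2 (r p.1) := lift_elem _ _ _
    have hM (d : ℕ+) : F.toRingHom (M d) = r d := by
      rw [← incl_elem_one]
      exact (hF (d, 1)).trans (K.lam_one _)
    have helem (p : ℕ+ × ℕ+) : F.toRingHom (elem p) = K.lam p.2 (F.toRingHom (M p.1)) := by
      rw [hF, hM]
    exact ⟨⟨F, fun k _ => map_lam_of_map_elem hK F.toRingHom helem k⟩,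
      funext fun d => Subtype.ext (hM d)⟩

end PolySymFun

theorem mainTheorem6 :
    ∃ (LΛ : LambdaStructure SymFun) (L : LambdaStructure PolySymFun),
      -- the usual `λ`-structures: Adams operations raise all variables to the `n`-th power
      (∀ (n : ℕ) (hn : n ≠ 0) (f : SymFun),
        (LΛ.adams n f : MvPowerSeries ℕ+ ℤ) = MvPowerSeries.expand n hn f) ∧
      (∀ (n : ℕ) (hn : n ≠ 0) (f : PolySymFun),
        (L.adams n f : MvPowerSeries (ℕ+ × ℕ+) ℤ) = MvPowerSeries.expand n hn f) ∧
      -- `Λ⟨n⟩` and `PS` are special graded `λ`-rings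
      LΛ.IsSpecial ∧
      (∀ n : ℕ+, LΛ.IsGraded (scaledGrading SymFun.grading n)) ∧
      L.IsSpecial ∧
      L.IsGraded PolySymFun.grading ∧
      -- the inclusions `Λ⟨n⟩ → PS` commute with the `λ`-operations
      (∀ (n : ℕ+) (k : ℕ) (f : SymFun),
        PolySymFun.incl n (LΛ.lam k f) = L.lam k (PolySymFun.incl n f)) ∧
      -- `PS = ⨂ Λ⟨n⟩`, the coproduct of graded rings
      (∀ (S : Type u) [CommRing S] (𝒮 : ℕ → AddSubgroup S) [GradedRing 𝒮]
        (f : ∀ n : ℕ+, GradedRingHom (scaledGrading SymFun.grading n) 𝒮),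
        ∃! F : GradedRingHom PolySymFun.grading 𝒮,
          ∀ (n : ℕ+) (x : SymFun), F (PolySymFun.incl n x) = f n x) ∧
      -- `PS` is the coproduct of the `Λ⟨n⟩` among special graded `λ`-rings
      (∀ (R : Type u) [CommRing R] (𝒜 : ℕ → AddSubgroup R) [GradedRing 𝒜]
        (K : LambdaStructure R), K.IsSpecial → K.IsGraded 𝒜 →
        ∀ f : ∀ n : ℕ+, GradedLambdaHom (scaledGrading SymFun.grading n) LΛ 𝒜 K,
        ∃! F : GradedLambdaHom PolySymFun.grading L 𝒜 K,
          ∀ (n : ℕ+) (x : SymFun),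
            F.toRingHom (PolySymFun.incl n x) = (f n).toRingHom x) ∧
      -- the universal property
      (∀ (R : Type u) [CommRing R] (𝒜 : ℕ → AddSubgroup R) [GradedRing 𝒜]
        (K : LambdaStructure R), K.IsSpecial → K.IsGraded 𝒜 →
        Function.Bijective
          (fun (φ : GradedLambdaHom PolySymFun.grading L 𝒜 K) (d : ℕ+) =>
            (⟨φ.toRingHom (PolySymFun.M d), φ.map_mem (PolySymFun.M_mem d)⟩ : 𝒜 (d : ℕ)))) := by
  exact ⟨invariantsLambda _, invariantsLambda _,
    fun _ hn f => coe_adams_invariantsLambda hn f,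
    fun _ hn f => coe_adams_invariantsLambda hn f,
    isSpecial_invariantsLambda, SymFun.isGraded_scaledGrading,
    isSpecial_invariantsLambda, isGraded_invariantsLambda, PolySymFun.incl_lam,
    fun _ _ 𝒮 _ f => PolySymFun.existsUnique_gradedRingHom 𝒮 f,
    fun _ _ 𝒜 _ _ hK _ f => PolySymFun.existsUnique_gradedLambdaHom 𝒜 hK f,
    fun _ _ 𝒜 _ _ hK hgr => PolySymFun.bijective_eval_M 𝒜 hK hgr⟩
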